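/- A shift of finite type is the set $X$ of all one-sided sequences in $\Lambda^{\mathbb N}$ or all two-sided sequences in $\Lambda^{\mathbb Z}$ ($\Lambda$ a finite alphabet) which avoid a given finite set of finite patterns, with the shift map $\sigma$ and the metric $d(x,y)=2^{-\min\{|i|\,:\,x_i\neq y_i\}}$ for $x\ne y$. For a Hölder function (potential) $\phi:X\to\mathbb R$, its pressure is $$P(\phi)=\limsup_{m\to\infty}\frac1m\log\sum_{x\in X,\ \sigma^m x=x}\exp\Big(\sum_{i=0}^{m-1}\phi(\sigma^i x)\Big),$$ which is a limit when $X$ is a full shift. For $\alpha>0$ let $\mathcal C_\alpha$ be the set of strictly convex, Lipschitz, real analytic functions $F:(\alpha,\infty)\to\mathbb R$ for which there are $0\le\underline\gamma\le\overline\gamma<\infty$ such that every supporting line of the graph of $F$ meets the vertical axis at a point of $\{0\}\times[\underline\gamma,\overline\gamma]$. Theorem. For every $\alpha>0$ there is an $F\in\mathcal C_\alpha$ such that there is no Hölder potential $\phi$ on any shift of finite type with $P(t\phi)=F(t)$ for all $t\in(\alpha,\infty)$. (This answers negatively the question of Kucherenko and Quas whether every convex, Lipschitz, analytic function whose supporting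 lines meet the vertical axis in a bounded closed interval in $[0,\infty)$ is the pressure function of some Hölder potential on some shift of finite type.) Explicitly, for all $\alpha>0$, $a,b>0$ and $c>\frac1{2\sqrt2}$, the function $$F_{a,b,c}(t)=at+b+e^{-ct^2}+\frac{e^{-ct^2}}{t}$$ on $(\alpha,\infty)$ belongs to $\mathcal C_\alpha$, and there is no Hölder potential $\phi$ on any shift of finite type with $P(t\phi)=F_{a,b,c}(t)$ for all $t\in(\alpha,\infty)$. -/

import Mathlib

open Set Filter SymbolicDynamics.FullShift

noncomputable section

/-- A shift of finite type: the subshift of all configurations avoiding finitely many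
finite patterns.  With `G = ℕ` these are the one-sided shifts, with `G = ℤ` the two-sided ones. -/
def IsShiftOfFiniteType {Λ G : Type} [Inhabited Λ] [TopologicalSpace Λ] [DiscreteTopology Λ]
    [AddMonoid G] [IsLeftCancelAdd G] (X : Subshift Λ G) : Prop :=
  ∃ W : Set (Pattern Λ G), W.Finite ∧ X = Subshift.ofForbidden W

/-- The shift map `(σ x) i = x (1 + i)` of a subshift. -/
def shiftMap {Λ G : Type} [TopologicalSpace Λ] [AddMonoidWithOne G] (X : Subshift Λ G) :
    X.carrier → X.carrier :=
  (X.mapsTo 1).restrict (shift (1 : G)) X.carrier X.carrier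

/-- The sum of `exp (S_m φ (x))` over the points `x` of `X` with `σ^m x = x`. -/
def periodicSum {Λ G : Type} [TopologicalSpace Λ] [AddMonoidWithOne G] (X : Subshift Λ G)
    (φ : X.carrier → ℝ) (m : ℕ) : ENNReal :=
  ∑' x : {x : X.carrier // Function.IsPeriodicPt (shiftMap X) m x},
    ENNReal.ofReal (Real.exp (birkhoffSum (shiftMap X) φ m x.1))

/-- The pressure `lim (1/m) log ∑_{σ^m x = x} exp (S_m φ (x))`.  On a full shift (or a topologically
mixing shift of finite type) the limit exists for continuous `φ`; the upper limit is what
gives the pressure on shifts of finite type with periods, where there may be no points with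
`σ^m x = x` for some `m`.  The value is `⊥` on the empty shift. -/
def pressure {Λ G : Type} [TopologicalSpace Λ] [AddMonoidWithOne G] (X : Subshift Λ G)
    (φ : X.carrier → ℝ) : EReal :=
  limsup (fun m : ℕ => ENNReal.log (periodicSum X φ m) / ((m : ℝ) : EReal)) atTop

open Classical in
/-- The visual metric `d(x,y) = 2^{-l(x,y)}`, where `l(x,y)` is the least `size i` over the
coordinates `i` with `x i ≠ y i`; here `size i = i` for one-sided and `size i = |i|` for
two-sided sequences. -/
def visualDist {Λ G : Type} (size : G → ℕ) (x y : G → Λ) : ℝ :=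
  if x = y then 0 else (1 / 2 : ℝ) ^ sInf {n : ℕ | ∃ i : G, size i = n ∧ x i ≠ y i}

/-- Hölder continuity, for some exponent `0 < h ≤ 1`, in the visual metric. -/
def IsHolderPotential {Λ G : Type} [TopologicalSpace Λ] [AddMonoid G] (size : G → ℕ)
    (X : Subshift Λ G) (φ : X.carrier → ℝ) : Prop :=
  ∃ C h : ℝ, 0 ≤ C ∧ 0 < h ∧ h ≤ 1 ∧
    ∀ x y : X.carrier, |φ x - φ y| ≤ C * visualDist size x.1 y.1 ^ h

/-- `F` agrees on `(α, ∞)` with `t ↦ P(tφ)` for some Hölder potential `φ` on some shift of finite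
type over the index set `G` (with a finite discrete alphabet). -/
def IsHolderPressureOver (G : Type) [AddMonoidWithOne G] [IsLeftCancelAdd G] (size : G → ℕ)
    (α : ℝ) (F : ℝ → ℝ) : Prop :=
  ∃ (Λ : Type) (_ : Finite Λ) (_ : Inhabited Λ) (_ : TopologicalSpace Λ)
    (_ : DiscreteTopology Λ) (X : Subshift Λ G) (φ : X.carrier → ℝ),
    IsShiftOfFiniteType X ∧ IsHolderPotential size X φ ∧
      ∀ t ∈ Ioi α, pressure X (t • φ) = (F t : EReal)

/-- Realisability by a Hölder potential on a one-sided or two-sided shift of finite type. -/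
def IsHolderPressure (α : ℝ) (F : ℝ → ℝ) : Prop :=
  IsHolderPressureOver ℕ id α F ∨ IsHolderPressureOver ℤ Int.natAbs α F

/-- All supporting lines of the graph of `F` over `(α, ∞)` meet the vertical axis in a bounded
closed interval contained in `[0, ∞)`. -/
def SupportingLinesBounded (α : ℝ) (F : ℝ → ℝ) : Prop :=
  ∃ γ₁ γ₂ : ℝ, 0 ≤ γ₁ ∧ γ₁ ≤ γ₂ ∧
    ∀ t ∈ Ioi α, ∀ k : ℝ, (∀ s ∈ Ioi α, F t + k * (s - t) ≤ F s) → F t - k * t ∈ Icc γ₁ γ₂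

/-- Strictly convex, Lipschitz, real analytic functions on `(α, ∞)` whose supporting lines meet the
vertical axis in a bounded interval inside `[0, ∞)`. -/
def IsCandidate (α : ℝ) (F : ℝ → ℝ) : Prop :=
  StrictConvexOn ℝ (Ioi α) F ∧ AnalyticOnNhd ℝ F (Ioi α) ∧
    (∃ L, LipschitzOnWith L F (Ioi α)) ∧ SupportingLinesBounded α F

/-- The functions `a t + b + exp (-c t²) + exp (-c t²) / t`. -/
def explicitF (a b c t : ℝ) : ℝ :=
  a * t + b + Real.exp (-c * t ^ 2) + Real.exp (-c * t ^ 2) / t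

end

/-! The explicit functions are `a t + b + g t` with `g` eventually positive but smaller than every
exponential. A pressure cannot behave like this: the excess over its asymptote would have to be at
least exponential in `-t`.

Subtracting the slope `a` from the potential makes all sums over periodic orbits nonpositive
(`birkhoffSum_le_of_pressure`), and recoding by windows makes the shift Markov
(`exists_markovPeriodicSystem`). Fix a symbol and look at the periodic points through it. If all of
them have sum zero, their weighted count is independent of `t`, so its rate at `t` is bounded by `b
+ g t'` for large `t'`, hence lies below `b + g t`. Otherwise some orbit has a negative sum, and
going round it many times yields markers: cells of very negative value which link any two cells
(`exists_markers`).

Call a chain of cells good if its sum is at least `-D`, and measure `b` per cell. If for some length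
`L` there are fewer than `exp (L b)` good chains, every other block of that length costs a factor
`exp (-t)`, and the rate drops below `b` for large `t` (`exists_rate_lt_of_card_goodChains_lt`). If
not, markers inserted freely between good chains, each at a price exponential in `-t`, raise the
rate by the logarithm of one plus this price (`le_sum_chains_of_markers`). That exceeds any multiple
of `g t`, contradicting the pressure.

So for large `t` each symbol contributes a rate strictly below `b + g t`. There are finitely many
symbols, hence so does the whole sum (`not_superexponential_rate`). Treating symbols separately
avoids any transitivity assumption. -/

section ChainSums

/-! ### Chain sums of almost additive functions. -/

variable {E : Type*} [Finite E] {R : E → E → Prop}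

variable (R) in
/-- The finite set of all `R`-chains of length `n`. -/
noncomputable def chains (n : ℕ) : Finset (List E) :=
  ((List.finite_length_eq E n).subset
    (t := {l : List E | l.length = n ∧ l.IsChain R}) (fun _ h => h.1)).toFinset

lemma mem_chains {n : ℕ} {l : List E} : l ∈ chains R n ↔ l.length = n ∧ l.IsChain R := by
  simp [chains]

open Classical in
variable (R) in
/-- The chains of length `n` on which `S` is at least `-D`. -/
noncomputable def goodChains (S : List E → ℝ) (D : ℝ) (n : ℕ) : Finset (List E) :=
  (chains R n).filter (fun w => -D ≤ S w)

lemma mem_goodChains {S : List E → ℝ} {D : ℝ} {n : ℕ} {w : List E} :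
    w ∈ goodChains R S D n ↔ (w.length = n ∧ w.IsChain R) ∧ -D ≤ S w := by
  simp [goodChains, mem_chains]

/-- Cutting at position `m` is injective. There is no equality, since two chains need not
concatenate to a chain. -/
lemma sum_chains_add_le (f : List E → ℝ) (hf : ∀ x, 0 ≤ f x) (m n : ℕ) :
    ∑ x ∈ chains R (m + n), f x ≤ ∑ w ∈ chains R m, ∑ x ∈ chains R n, f (w ++ x) := by
  classical
  rw [← Finset.sum_product']
  have h1 : ∑ x ∈ chains R (m + n), f x =
      ∑ p ∈ (chains R (m + n)).image (fun x => (x.take m, x.drop m)), f (p.1 ++ p.2) := by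
    rw [Finset.sum_image]
    · simp
    · intro x _ y _ h
      simp only [Prod.mk.injEq] at h
      rw [← List.take_append_drop m x, h.1, h.2, List.take_append_drop]
  rw [h1]
  refine Finset.sum_le_sum_of_subset_of_nonneg ?_ (fun _ _ _ => hf _)
  intro p hp
  obtain ⟨x, hx, rfl⟩ := Finset.mem_image.1 hp
  rw [mem_chains] at hx
  simp only [Finset.mem_product, mem_chains]
  refine ⟨⟨by simp [hx.1], hx.2.take _⟩, ⟨by simp [hx.1], hx.2.drop _⟩⟩

variable {S : List E → ℝ} {K C : ℝ}

open Classical in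
/-- Every block of length `L` on which `S` is very negative costs a factor `exp (-t)`. -/
lemma sum_chains_mul_le
    (hadd : ∀ u v : List E, (u ++ v).IsChain R → |S (u ++ v) - S u - S v| ≤ K)
    (hC : ∀ w : List E, w.IsChain R → S w ≤ C) {D : ℝ} (hD : C + 2 * K + 1 ≤ D)
    {t : ℝ} (ht : 0 ≤ t) (L k : ℕ) (u : List E) (hu : u.IsChain R) :
    ∑ x ∈ chains R (k * L), (if (u ++ x).IsChain R then Real.exp (t * S (u ++ x)) else 0) ≤
      Real.exp (t * C) *
        ((goodChains R S D L).card + (chains R L).card * Real.exp (-t)) ^ k := by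
  set θ : ℝ := (goodChains R S D L).card + (chains R L).card * Real.exp (-t) with hθ
  have hθ0 : 0 ≤ θ := by positivity
  induction k generalizing u with
  | zero =>
    have : chains R (0 * L) = {[]} := by
      ext l; rw [mem_chains]; simp only [zero_mul, List.length_eq_zero_iff, Finset.mem_singleton]
      constructor
      · exact fun h => h.1
      · rintro rfl; simp
    rw [this]
    simp only [Finset.sum_singleton, List.append_nil, hu, if_true, pow_zero, mul_one]
    exact Real.exp_le_exp.2 (mul_le_mul_of_nonneg_left (hC u hu) ht)
  | succ k ih =>
    have e : (k + 1) * L = L + k * L := by ring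
    rw [e]
    refine (sum_chains_add_le _ (fun x => by split_ifs <;> positivity) L (k * L)).trans ?_
    -- A good block is absorbed into the prefix `u`. A bad one is discarded together with `u`, and
    -- the induction restarts from the empty prefix; so the factor `exp (t * C)` is paid only once.
    have key : ∀ w ∈ chains R L, ∑ x ∈ chains R (k * L),
        (if (u ++ (w ++ x)).IsChain R then Real.exp (t * S (u ++ (w ++ x))) else 0) ≤
        (Real.exp (t * C) * θ ^ k) * ((if -D ≤ S w then 1 else 0) + Real.exp (-t)) := by
      intro w hw
      rw [mem_chains] at hw
      have hnn : 0 ≤ Real.exp (t * C) * θ ^ k := by positivity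
      by_cases hg : -D ≤ S w
      · rw [if_pos hg]
        by_cases huw : (u ++ w).IsChain R
        · have := ih (u ++ w) huw
          simp only [List.append_assoc] at this
          refine this.trans ?_
          nlinarith [Real.exp_pos (-t)]
        · rw [Finset.sum_eq_zero]
          · positivity
          · intro x _
            rw [if_neg]
            rw [← List.append_assoc]
            exact fun h => huw h.left_of_append
      · rw [if_neg hg, zero_add, mul_comm (Real.exp (t * C) * θ ^ k)]
        refine le_trans ?_ (mul_le_mul_of_nonneg_left (ih [] (by simp)) (Real.exp_pos _).le)
        rw [Finset.mul_sum]
        refine Finset.sum_le_sum fun x _ => ?_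
        by_cases hx : (u ++ (w ++ x)).IsChain R
        · have hwx := hx.right_of_append
          have hxx := hwx.right_of_append
          rw [if_pos hx, List.nil_append, if_pos hxx, ← Real.exp_add]
          apply Real.exp_le_exp.2
          have h1 := (abs_le.1 (hadd _ _ hx)).2
          have h2 := (abs_le.1 (hadd _ _ hwx)).2
          have h3 := hC u hu
          -- Two junctions cost `2 * K`, the prefix gives at most `C` and the bad block less than
          -- `-D`: this is where `D ≥ C + 2 * K + 1` comes from.
          have : S (u ++ (w ++ x)) ≤ -1 + S x := by push Not at hg; linarith
          nlinarith
        · rw [if_neg hx]; split_ifs <;> positivity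
    refine (Finset.sum_le_sum key).trans ?_
    rw [← Finset.mul_sum, Finset.sum_add_distrib, pow_succ, ← mul_assoc]
    refine mul_le_mul_of_nonneg_left ?_ (by positivity)
    rw [hθ]
    simp [goodChains]

/-- If for one block length there are fewer than `exp (L b)` good chains, then for large `t` the
exponential growth rate of the chain sums is less than `b`. -/
lemma exists_rate_lt_of_card_goodChains_lt
    (hadd : ∀ u v : List E, (u ++ v).IsChain R → |S (u ++ v) - S u - S v| ≤ K)
    (hC : ∀ w : List E, w.IsChain R → S w ≤ C) {D : ℝ} (hD : C + 2 * K + 1 ≤ D)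
    {b : ℝ} {L : ℕ} (hL : 1 ≤ L) (hN : ((goodChains R S D L).card : ℝ) < Real.exp (L * b)) :
    ∀ᶠ t in atTop, ∃ θ < b, ∃ c, ∀ n : ℕ,
      ∑ w ∈ chains R n, Real.exp (t * S w) ≤ c * Real.exp (n * θ) := by
  classical
  have hlim : Tendsto (fun t : ℝ => ((goodChains R S D L).card : ℝ) +
      (chains R L).card * Real.exp (-t)) atTop (nhds ((goodChains R S D L).card +
        (chains R L).card * 0)) :=
    tendsto_const_nhds.add (Real.tendsto_exp_neg_atTop_nhds_zero.const_mul _)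
  rw [mul_zero, add_zero] at hlim
  filter_upwards [hlim.eventually_lt_const hN, eventually_ge_atTop 0] with t h1 ht
  set q : ℝ := (goodChains R S D L).card + (chains R L).card * Real.exp (-t) with hq
  have hq0 : 0 ≤ q := by positivity
  obtain ⟨q', hqq', hq'⟩ := exists_between h1
  have hL0 : (0 : ℝ) < L := by exact_mod_cast hL
  have hq'0 : 0 < q' := hq0.trans_lt hqq'
  set θ := Real.log q' / L with hθ
  have hθL : L * θ = Real.log q' := by rw [hθ]; field_simp
  refine ⟨θ, ?_, (∑ r ∈ Finset.range L, ((chains R r).card : ℝ)) * Real.exp (t * C) *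
    Real.exp (L * |θ|), fun n => ?_⟩
  · rw [hθ, div_lt_iff₀ hL0, Real.log_lt_iff_lt_exp hq'0, mul_comm]; exact hq'
  -- The incomplete block is put first, where it serves as the prefix `u` of `sum_chains_mul_le`.
  · obtain ⟨r, k, hr, hn⟩ : ∃ r k : ℕ, r < L ∧ n = r + k * L :=
      ⟨n % L, n / L, Nat.mod_lt _ hL, by rw [mul_comm]; exact (Nat.mod_add_div n L).symm⟩
    have step : ∑ w ∈ chains R n, Real.exp (t * S w) ≤
        (chains R r).card * (Real.exp (t * C) * q ^ k) := by
      calc ∑ w ∈ chains R n, Real.exp (t * S w)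
          = ∑ w ∈ chains R (r + k * L),
              (if w.IsChain R then Real.exp (t * S w) else 0) := by
            rw [← hn]
            refine Finset.sum_congr rfl fun w hw => ?_
            rw [if_pos (mem_chains.1 hw).2]
        _ ≤ _ := sum_chains_add_le _ (fun x => by split_ifs <;> positivity) _ _
        _ ≤ ∑ w ∈ chains R r, Real.exp (t * C) * q ^ k :=
            Finset.sum_le_sum fun w hw =>
              sum_chains_mul_le hadd hC hD ht L k w (mem_chains.1 hw).2
        _ = _ := by rw [Finset.sum_const, nsmul_eq_mul]
    refine step.trans ?_
    have h2 : ((chains R r).card : ℝ) ≤ ∑ r ∈ Finset.range L, ((chains R r).card : ℝ) :=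
      Finset.single_le_sum (f := fun r => ((chains R r).card : ℝ))
        (fun _ _ => Nat.cast_nonneg _) (Finset.mem_range.2 hr)
    have h3 : q ^ k ≤ Real.exp (L * |θ|) * Real.exp (n * θ) := by
      calc q ^ k ≤ q' ^ k := pow_le_pow_left₀ hq0 hqq'.le k
        _ = Real.exp (k * (L * θ)) := by
          rw [hθL, Real.exp_nat_mul, Real.exp_log hq'0]
        _ ≤ _ := by
          rw [← Real.exp_add]
          apply Real.exp_le_exp.2
          have : (n : ℝ) = r + k * L := by exact_mod_cast hn
          rw [this]
          have h4 : (r : ℝ) ≤ L := by exact_mod_cast hr.le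
          have h5 : 0 ≤ (r : ℝ) := by positivity
          nlinarith [neg_abs_le θ, abs_nonneg θ]
    calc ((chains R r).card : ℝ) * (Real.exp (t * C) * q ^ k)
        ≤ (∑ r ∈ Finset.range L, ((chains R r).card : ℝ)) *
          (Real.exp (t * C) * (Real.exp (L * |θ|) * Real.exp (n * θ))) :=
          mul_le_mul h2 (mul_le_mul_of_nonneg_left h3 (Real.exp_pos _).le)
            (mul_nonneg (Real.exp_pos _).le (pow_nonneg hq0 k))
            (Finset.sum_nonneg fun _ _ => Nat.cast_nonneg _)
      _ = _ := by ring

/-- A good chain contains no element `m` with `S [m]` very negative. -/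
lemma notMem_of_goodChains
    (hadd : ∀ u v : List E, (u ++ v).IsChain R → |S (u ++ v) - S u - S v| ≤ K)
    (hC : ∀ w : List E, w.IsChain R → S w ≤ C) {D : ℝ} {n : ℕ} {w : List E}
    (hw : w ∈ goodChains R S D n) {m : E} (hm : S [m] < -(D + 2 * C + 2 * K)) : m ∉ w := by
  intro h
  obtain ⟨x, y, rfl⟩ := List.append_of_mem h
  rw [mem_goodChains] at hw
  obtain ⟨⟨-, hch⟩, hS⟩ := hw
  have h1 := (abs_le.1 (hadd _ _ hch)).2
  have hmy : ([m] ++ y).IsChain R := hch.right_of_append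
  have h2 := (abs_le.1 (hadd _ _ hmy)).2
  have h3 := hC _ hch.left_of_append
  have h4 := hC _ hmy.right_of_append
  simp only [List.singleton_append] at h2
  linarith

lemma takeWhile_append_eq_left {α : Type*} {p : α → Bool} {w x : List α} (hw : ∀ a ∈ w, p a)
    (hx : ∀ a ∈ x.head?, p a = false) : (w ++ x).takeWhile p = w := by
  rw [List.takeWhile_append_of_pos hw]
  cases x with
  | nil => simp
  | cons a x => simp [hx a (by simp)]

/-- Chains built from good chains separated by markers: if there are at least `exp (n b)` good
chains of every length `n`, then markers can be inserted freely, at a bounded cost for each, and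
this raises the growth rate above `b`. -/
lemma exists_marked_chains (hS0 : S [] = 0)
    (hadd : ∀ u v : List E, (u ++ v).IsChain R → |S (u ++ v) - S u - S v| ≤ K)
    (hC : ∀ w : List E, w.IsChain R → S w ≤ C) {D : ℝ}
    {b : ℝ} (hN : ∀ n : ℕ, Real.exp (n * b) ≤ (goodChains R S D n).card)
    (mk : E → E → E) (hmk1 : ∀ e f, R e (mk e f)) (hmk2 : ∀ e f, R (mk e f) f)
    (hmk : ∀ e f, S [mk e f] < -(D + 2 * C + 2 * K))
    {A₀ : ℝ} (hA₀ : ∀ e f, -A₀ ≤ S [mk e f])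
    {t : ℝ} (ht : 0 ≤ t) (n : ℕ) (e : E) :
    ∃ X : Finset (List E), (∀ x ∈ X, x.length = n ∧ (e :: x).IsChain R ∧
        ∀ y ∈ x.head?, y ∈ range (Function.uncurry mk)) ∧
      Real.exp (n * b) * (if n = 0 then 1 else Real.exp (-(t * (A₀ + D + 2 * K) + b)) *
        (1 + Real.exp (-(t * (A₀ + D + 2 * K) + b))) ^ (n - 1)) ≤
      ∑ x ∈ X, Real.exp (t * S x) := by
  classical
  -- The price of a marker: its own value, the good chain behind it and two junctions, and `exp
  -- (-b)` for the position it occupies.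
  set δ := Real.exp (-(t * (A₀ + D + 2 * K) + b)) with hδ
  have hδ0 : 0 < δ := Real.exp_pos _
  -- Solution of the renewal equation `v (n + 1) = δ * ∑ m ≤ n, v m`, `v 0 = 1`, obtained by
  -- splitting off the first marker and the good chain after it.
  set v : ℕ → ℝ := fun n => if n = 0 then 1 else δ * (1 + δ) ^ (n - 1) with hv
  have hv0 : ∀ n, 0 ≤ v n := fun n => by simp only [hv]; split_ifs <;> positivity
  have hvsum : ∀ n, ∑ m ∈ Finset.range (n + 1), v m = (1 + δ) ^ n := by
    intro n
    induction n with
    | zero => simp [hv]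
    | succ n ih => rw [Finset.sum_range_succ, ih]; simp only [hv]; simp; ring
  change ∃ X : Finset (List E), _ ∧ Real.exp (n * b) * v n ≤ _
  induction n using Nat.strong_induction_on generalizing e with
  | _ n ih =>
  rcases n with _ | n
  · exact ⟨{[]}, by simp, by simp [hv, hS0]⟩
  · have ih' : ∀ m : ℕ, ∀ e : E, ∃ X : Finset (List E), m ≤ n →
        (∀ x ∈ X, x.length = m ∧ (e :: x).IsChain R ∧
          ∀ y ∈ x.head?, y ∈ range (Function.uncurry mk)) ∧
        Real.exp (m * b) * v m ≤ ∑ x ∈ X, Real.exp (t * S x) := by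
      intro m e
      by_cases hm : m ≤ n
      · obtain ⟨X, hX⟩ := ih m (Nat.lt_succ_of_le hm) e
        exact ⟨X, fun _ => hX⟩
      · exact ⟨∅, fun h => absurd h hm⟩
    choose X hX using ih'
    -- `q w` is the marker from `e` to the good chain `w` (to `e` itself if `w` is empty), and `l w`
    -- is the last element of `q w :: w`, from which the remaining chain continues.
    let q : List E → E := fun w => mk e (w.headD e)
    let l : List E → E := fun w => (q w :: w).getLast (by simp)
    let I : Finset (Σ _ : ℕ, Σ _ : List E, List E) :=
      (Finset.range (n + 1)).sigma fun g =>
        (goodChains R S D g).sigma fun w => X (n - g) (l w)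
    let f : (Σ _ : ℕ, Σ _ : List E, List E) → List E := fun p => q p.2.1 :: (p.2.1 ++ p.2.2)
    have hI : ∀ p ∈ I, p.1 ≤ n ∧ p.2.1 ∈ goodChains R S D p.1 ∧
        p.2.2 ∈ X (n - p.1) (l p.2.1) := by
      intro p hp
      simp only [I, Finset.mem_sigma, Finset.mem_range] at hp
      exact ⟨by omega, hp.2.1, hp.2.2⟩
    have hnm : ∀ p ∈ I, ∀ a ∈ p.2.1, a ∉ range (Function.uncurry mk) := by
      rintro p hp a ha ⟨⟨e₁, e₂⟩, rfl⟩
      exact notMem_of_goodChains hadd hC (hI p hp).2.1 (hmk e₁ e₂) ha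
    -- Good chains contain no markers and the remainder is empty or starts with one, so the first
    -- marker after the head shows where `w` ends.
    have hinj : Set.InjOn f I := by
      rintro ⟨g, w, x⟩ hp ⟨g', w', x'⟩ hp' h
      have hwx : w ++ x = w' ++ x' := (List.cons.inj h).2
      have tw : ∀ p ∈ I, (p.2.1 ++ p.2.2).takeWhile
          (fun a => decide (a ∉ range (Function.uncurry mk))) = p.2.1 := by
        intro p hp
        refine takeWhile_append_eq_left (fun a ha => by simpa using hnm p hp a ha) ?_
        intro a ha
        have := ((hX _ _ (Nat.sub_le n p.1)).1 _ (hI p hp).2.2).2.2 a ha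
        simpa using this
      have h1 : w = w' := by
        have h1 := tw _ hp
        have h2 := tw _ hp'
        simp only [hwx] at h1 h2
        exact h1.symm.trans h2
      subst h1
      have h2 : x = x' := List.append_cancel_left hwx
      subst h2
      have h3 := (mem_goodChains.1 (hI _ hp).2.1).1.1
      have h4 := (mem_goodChains.1 (hI _ hp').2.1).1.1
      simp only at h3 h4
      rw [← h3, ← h4]
    have hch : ∀ p ∈ I, (f p).length = n + 1 ∧ (e :: f p).IsChain R := by
      rintro ⟨g, w, x⟩ hp
      obtain ⟨hg, hw, hx⟩ := hI _ hp
      simp only at hg hw hx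
      obtain ⟨hxl, hxc, -⟩ := (hX _ _ (Nat.sub_le n g)).1 x hx
      obtain ⟨⟨hwl, hwc⟩, -⟩ := mem_goodChains.1 hw
      refine ⟨by simp [f, hxl, hwl]; omega, ?_⟩
      refine List.isChain_cons_cons.2 ⟨hmk1 _ _, ?_⟩
      rw [← List.cons_append]
      refine List.isChain_append.2 ⟨?_, hxc.tail, ?_⟩
      · cases w with
        | nil => simp
        | cons a w => exact List.isChain_cons_cons.2 ⟨hmk2 _ _, hwc⟩
      · intro a ha y hy
        have : l w = a := by
          rw [List.getLast?_eq_getLast_of_ne_nil (by simp)] at ha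
          simpa using ha
        subst this
        cases x with
        | nil => simp at hy
        | cons z x =>
          simp only [List.head?_cons, Option.mem_def, Option.some.injEq] at hy
          subst hy
          exact (List.isChain_cons_cons.1 hxc).1
    refine ⟨I.image f, ?_, ?_⟩
    · intro x hx
      obtain ⟨p, hp, rfl⟩ := Finset.mem_image.1 hx
      refine ⟨(hch p hp).1, (hch p hp).2, ?_⟩
      intro y hy
      simp only [f, List.head?_cons, Option.mem_def, Option.some.injEq] at hy
      exact ⟨(e, p.2.1.headD e), hy⟩
    · rw [Finset.sum_image hinj]
      have hlow : ∀ p ∈ I, Real.exp (-(t * (A₀ + D + 2 * K))) * Real.exp (t * S p.2.2) ≤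
          Real.exp (t * S (f p)) := by
        rintro ⟨g, w, x⟩ hp
        rw [← Real.exp_add]
        apply Real.exp_le_exp.2
        have hc := (hch _ hp).2.tail
        have h1 := (abs_le.1 (hadd [q w] (w ++ x) hc)).1
        have h2 := (abs_le.1 (hadd w x hc.tail)).1
        have h3 := hA₀ e (w.headD e)
        have h4 := (mem_goodChains.1 (hI _ hp).2.1).2
        simp only at h4
        have : S x - (A₀ + D + 2 * K) ≤ S (q w :: (w ++ x)) := by
          simp only [List.singleton_append] at h1
          linarith
        simp only [f]
        nlinarith
      refine le_trans ?_ (Finset.sum_le_sum hlow)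
      simp only [I, Finset.sum_sigma]
      have hstep : ∀ g ∈ Finset.range (n + 1),
          Real.exp (-(t * (A₀ + D + 2 * K))) * Real.exp (n * b) * v (n - g) ≤
          ∑ w ∈ goodChains R S D g, ∑ x ∈ X (n - g) (l w),
            Real.exp (-(t * (A₀ + D + 2 * K))) * Real.exp (t * S x) := by
        intro g hg
        have hgn : g ≤ n := by simpa [Nat.lt_succ_iff] using hg
        have h1 : ∀ w ∈ goodChains R S D g,
            Real.exp (-(t * (A₀ + D + 2 * K))) * (Real.exp ((n - g : ℕ) * b) * v (n - g)) ≤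
            ∑ x ∈ X (n - g) (l w), Real.exp (-(t * (A₀ + D + 2 * K))) * Real.exp (t * S x) := by
          intro w _
          rw [← Finset.mul_sum]
          exact mul_le_mul_of_nonneg_left (hX _ _ (Nat.sub_le n g)).2 (Real.exp_pos _).le
        refine le_trans ?_ (Finset.sum_le_sum h1)
        rw [Finset.sum_const, nsmul_eq_mul]
        refine le_trans ?_ (mul_le_mul_of_nonneg_right (hN g) ?_)
        · have : Real.exp (n * b) = Real.exp (g * b) * Real.exp ((n - g : ℕ) * b) := by
            rw [← Real.exp_add, Nat.cast_sub hgn]; ring_nf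
          rw [this]
          apply le_of_eq; ring
        · have := hv0 (n - g); positivity
      refine le_trans ?_ (Finset.sum_le_sum hstep)
      rw [← Finset.mul_sum]
      have hrefl : ∑ g ∈ Finset.range (n + 1), v (n - g) = (1 + δ) ^ n := by
        rw [← hvsum n, ← Finset.sum_range_reflect]
        refine Finset.sum_congr rfl fun g hg => ?_
        have := Finset.mem_range.1 hg
        congr 1; omega
      rw [hrefl]
      have h5 : Real.exp (-(t * (A₀ + D + 2 * K))) * Real.exp (n * b) =
          Real.exp ((n + 1 : ℕ) * b) * δ := by
        rw [hδ, ← Real.exp_add, ← Real.exp_add]; push_cast; ring_nf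
      rw [h5]
      simp only [hv]
      simp
      apply le_of_eq; ring

/-- The number `A` is fixed before `t`, so the gain decays at a definite exponential rate. Only `c`
depends on `t`. -/
lemma le_sum_chains_of_markers [Nonempty E] (hS0 : S [] = 0)
    (hadd : ∀ u v : List E, (u ++ v).IsChain R → |S (u ++ v) - S u - S v| ≤ K)
    (hC : ∀ w : List E, w.IsChain R → S w ≤ C) {D : ℝ}
    {b : ℝ} (hN : ∀ n : ℕ, Real.exp (n * b) ≤ (goodChains R S D n).card)
    (mk : E → E → E) (hmk1 : ∀ e f, R e (mk e f)) (hmk2 : ∀ e f, R (mk e f) f)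
    (hmk : ∀ e f, S [mk e f] < -(D + 2 * C + 2 * K)) :
    ∃ A : ℝ, 0 ≤ A ∧ ∀ t : ℝ, 0 ≤ t → ∃ c > 0, ∀ n : ℕ,
      c * Real.exp (n * (b + Real.log (1 + Real.exp (-(t * A + b))))) ≤
        ∑ w ∈ chains R n, Real.exp (t * S w) := by
  obtain ⟨A₁, hA₁⟩ : ∃ A₁, ∀ e f, -A₁ ≤ S [mk e f] := by
    obtain ⟨M, hM⟩ := (Set.finite_range (fun p : E × E => -S [mk p.1 p.2])).bddAbove
    refine ⟨M, fun e f => ?_⟩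
    have := hM (mem_range_self (e, f))
    simp only at this
    linarith
  set A₀ := max A₁ (-(D + 2 * K)) with hA
  have hA₀ : ∀ e f, -A₀ ≤ S [mk e f] := fun e f =>
    le_trans (neg_le_neg (le_max_left _ _)) (hA₁ e f)
  refine ⟨A₀ + D + 2 * K, ?_, fun t ht => ?_⟩
  · have := le_max_right A₁ (-(D + 2 * K)); linarith
  set δ := Real.exp (-(t * (A₀ + D + 2 * K) + b)) with hδ
  have hδ0 : 0 < δ := Real.exp_pos _
  refine ⟨min 1 (δ / (1 + δ)), by positivity, fun n => ?_⟩
  obtain ⟨X, hX, hsum⟩ := exists_marked_chains hS0 hadd hC hN mk hmk1 hmk2 hmk hA₀ ht n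
    (Classical.arbitrary E)
  have hsub : X ⊆ chains R n := fun x hx => mem_chains.2 ⟨(hX x hx).1, (hX x hx).2.1.tail⟩
  refine le_trans ?_ (hsum.trans (Finset.sum_le_sum_of_subset_of_nonneg hsub
    (fun _ _ _ => (Real.exp_pos _).le)))
  rw [← hδ, mul_add, Real.exp_add, Real.exp_nat_mul (Real.log _), Real.exp_log (by positivity)]
  rw [mul_left_comm]
  refine mul_le_mul_of_nonneg_left ?_ (Real.exp_pos _).le
  rcases n with _ | n
  · simp
  · simp only [Nat.add_eq_zero_iff, one_ne_zero, and_false, if_false, Nat.add_sub_cancel]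
    calc min 1 (δ / (1 + δ)) * (1 + δ) ^ (n + 1)
        ≤ δ / (1 + δ) * (1 + δ) ^ (n + 1) := by gcongr; exact min_le_right _ _
      _ = δ * (1 + δ) ^ n := by rw [pow_succ]; field_simp

end ChainSums

/-! ### Periodic sequences, walks and reachability. -/

section Walks

variable {A : Type*}

/-- The one-sided shift on sequences. -/
def seqTail (y : ℕ → A) : ℕ → A := fun i => y (i + 1)

lemma seqTail_iterate (m : ℕ) (y : ℕ → A) (i : ℕ) : seqTail^[m] y i = y (i + m) := by
  induction m generalizing y with
  | zero => rfl
  | succ m ih => rw [Function.iterate_succ_apply, ih]; simp only [seqTail, add_assoc]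

lemma isPeriodicPt_seqTail_iff {m : ℕ} {y : ℕ → A} :
    Function.IsPeriodicPt seqTail m y ↔ ∀ i, y (i + m) = y i := by
  simp only [Function.IsPeriodicPt, Function.IsFixedPt, funext_iff, seqTail_iterate]

/-- The list of the first `n` terms of a sequence. -/
def seqPrefix (n : ℕ) (y : ℕ → A) : List A := (List.range n).map y

@[simp] lemma length_seqPrefix (n : ℕ) (y : ℕ → A) : (seqPrefix n y).length = n := by
  simp [seqPrefix]

lemma seqPrefix_add (m n : ℕ) (y : ℕ → A) :
    seqPrefix (m + n) y = seqPrefix m y ++ seqPrefix n (seqTail^[m] y) := by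
  simp [seqPrefix, List.range_add, seqTail_iterate, add_comm, Function.comp_def]

lemma seqPrefix_eq_iff {n : ℕ} {y z : ℕ → A} :
    seqPrefix n y = seqPrefix n z ↔ ∀ j < n, y j = z j := by
  simp [seqPrefix, List.map_inj_left]

lemma eq_of_seqPrefix_eq {m : ℕ} (hm : 0 < m) {y z : ℕ → A}
    (hy : Function.IsPeriodicPt seqTail m y) (hz : Function.IsPeriodicPt seqTail m z)
    (h : seqPrefix m y = seqPrefix m z) : y = z := by
  rw [isPeriodicPt_seqTail_iff] at hy hz
  have hy' : Function.Periodic y m := hy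
  have hz' : Function.Periodic z m := hz
  funext j
  rw [← hy'.map_mod_nat j, ← hz'.map_mod_nat j]
  exact seqPrefix_eq_iff.1 h _ (Nat.mod_lt _ hm)

/-- `l` is the list of vertices, without the last one, of a walk from `a` to `b`. -/
def IsWalk (r : A → A → Prop) (l : List A) (a b : A) : Prop :=
  (l ++ [b]).IsChain r ∧ (l ++ [b]).head? = some a

variable {r : A → A → Prop}

lemma IsWalk.append {l₁ l₂ : List A} {a b c : A} (h₁ : IsWalk r l₁ a b) (h₂ : IsWalk r l₂ b c) :
    IsWalk r (l₁ ++ l₂) a c := by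
  obtain ⟨x, hx⟩ : ∃ x, l₂ ++ [c] = b :: x := by
    have := h₂.2
    cases h : l₂ ++ [c] with
    | nil => simp at h
    | cons y x => rw [h] at this; simp at this; exact ⟨x, by rw [this]⟩
  have h2 := h₂.1
  rw [hx] at h2
  constructor
  · rw [List.append_assoc, hx]
    have := h₁.1.append_overlap (l₃ := x) (by simpa using h2) (by simp)
    simpa using this
  · rw [List.append_assoc, hx]
    have := h₁.2
    cases l₁ <;> simpa using this

lemma IsWalk.split {l₁ l₂ : List A} {a c : A} (h : IsWalk r (l₁ ++ l₂) a c) :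
    ∃ b, IsWalk r l₁ a b ∧ IsWalk r l₂ b c := by
  cases l₂ with
  | nil => exact ⟨c, by simpa using h, by simp [IsWalk]⟩
  | cons b l₂ =>
    refine ⟨b, ⟨?_, ?_⟩, ?_, by simp⟩
    · refine List.IsChain.left_of_append (l₂ := l₂ ++ [c]) ?_
      simpa using h.1
    · have := h.2
      cases l₁ <;> simpa using this
    · exact List.IsChain.right_of_append (l₁ := l₁) (by simpa using h.1)

lemma IsWalk.eq_of_mem_head? {l : List A} {a b x : A}
    (h : IsWalk r l a b) (hx : x ∈ l.head?) : x = a := by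
  have := h.2
  cases l with
  | nil => simp at hx
  | cons y l => simp at hx this; exact hx.symm.trans this

variable (r) in
/-- `b` can be reached from `a` in exactly `n` steps. -/
def Reach (n : ℕ) (a b : A) : Prop := ∃ l : List A, l.length = n ∧ IsWalk r l a b

lemma Reach.add {m n : ℕ} {a b c : A} (h₁ : Reach r m a b) (h₂ : Reach r n b c) :
    Reach r (m + n) a c := by
  obtain ⟨l₁, hl₁, h₁⟩ := h₁
  obtain ⟨l₂, hl₂, h₂⟩ := h₂
  exact ⟨l₁ ++ l₂, by simp [hl₁, hl₂], h₁.append h₂⟩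

lemma reach_add_iff {m n : ℕ} {a c : A} :
    Reach r (m + n) a c ↔ ∃ b, Reach r m a b ∧ Reach r n b c := by
  constructor
  · rintro ⟨l, hl, h⟩
    rw [← List.take_append_drop m l] at h
    obtain ⟨b, h1, h2⟩ := h.split
    exact ⟨b, ⟨_, by simp [hl], h1⟩, ⟨_, by simp [hl], h2⟩⟩
  · rintro ⟨b, h1, h2⟩
    exact h1.add h2

-- There are finitely many relations on a finite set, so `n ↦ Reach r n` is eventually periodic. A
-- time that is a multiple of the period beyond the preperiod gives an idempotent relation, which
-- replaces the decomposition into cyclic classes.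
variable (r) in
lemma exists_reach_mul_eq [Finite A] : ∃ T, 0 < T ∧ ∀ k, 0 < k → Reach r (k * T) = Reach r T := by
  obtain ⟨x, y, hne, hxy⟩ := Finite.exists_ne_map_eq_of_infinite (Reach r)
  wlog hlt : x < y generalizing x y
  · exact this y x hne.symm hxy.symm (by omega)
  obtain ⟨p, rfl⟩ : ∃ p, y = x + p := ⟨y - x, by omega⟩
  have hp : 0 < p := by omega
  have h1 : ∀ k, Reach r (x + k) = Reach r (x + k + p) := by
    intro k
    funext a c
    rw [add_right_comm x k p, eq_iff_iff, reach_add_iff, reach_add_iff, hxy]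
  have h2 : ∀ j n, x ≤ n → Reach r (n + j * p) = Reach r n := by
    intro j n hn
    obtain ⟨k, rfl⟩ := Nat.exists_eq_add_of_le hn
    induction j with
    | zero => simp
    | succ j ih =>
      rw [← ih, Nat.succ_mul, ← add_assoc, add_assoc x k, ← h1]
  -- A multiple of the period `p` which is at least the preperiod `x`.
  refine ⟨(x + 1) * p, by positivity, fun k hk => ?_⟩
  obtain ⟨k, rfl⟩ : ∃ k', k = k' + 1 := ⟨k - 1, by omega⟩
  have : (k + 1) * ((x + 1) * p) = (x + 1) * p + (k * (x + 1)) * p := by ring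
  rw [this, h2]
  nlinarith

lemma isWalk_seqPrefix {y : ℕ → A} (hy : ∀ i, r (y i) (y (i + 1))) (n : ℕ) :
    IsWalk r (seqPrefix n y) (y 0) (y n) := by
  have e : seqPrefix n y ++ [y n] = seqPrefix (n + 1) y := by
    simp [seqPrefix, List.range_succ]
  rw [IsWalk, e]
  constructor
  · rw [List.isChain_iff_getElem]
    intro i hi
    simpa [seqPrefix] using hy i
  · simp [seqPrefix, List.range_succ_eq_map]

end Walks

/-! ### Markov systems of periodic sequences. -/

/-- A shift-invariant set of periodic sequences which is determined by its set of pairs of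
consecutive symbols, with a bounded potential whose Birkhoff sums have bounded distortion and are
nonpositive over periods. -/
structure MarkovPeriodicSystem (A : Type*) where
  /-- the periodic sequences -/
  pts : Set (ℕ → A)
  exists_period : ∀ y ∈ pts, ∃ m, 0 < m ∧ Function.IsPeriodicPt seqTail m y
  tail_mem : ∀ y ∈ pts, seqTail y ∈ pts
  glue : ∀ y : ℕ → A, ∀ m, 0 < m → Function.IsPeriodicPt seqTail m y →
    (∀ i, ∃ z ∈ pts, z 0 = y i ∧ z 1 = y (i + 1)) → y ∈ pts
  /-- the potential -/
  pot : (ℕ → A) → ℝ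
  /-- a bound of the potential -/
  B : ℝ
  /-- the distortion constant -/
  K : ℝ
  abs_pot_le : ∀ y ∈ pts, |pot y| ≤ B
  distortion : ∀ y ∈ pts, ∀ z ∈ pts, ∀ n, (∀ j < n, y j = z j) →
    |birkhoffSum seqTail pot n y - birkhoffSum seqTail pot n z| ≤ K
  sum_nonpos : ∀ y ∈ pts, ∀ m, Function.IsPeriodicPt seqTail m y →
    birkhoffSum seqTail pot m y ≤ 0

namespace MarkovPeriodicSystem

variable {A : Type*} (Q : MarkovPeriodicSystem A)

/-- `a` is followed by `b` in some point of the system. -/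
def step (a b : A) : Prop := ∃ z ∈ Q.pts, z 0 = a ∧ z 1 = b

/-- The Birkhoff sums of the potential. -/
noncomputable abbrev sum (n : ℕ) (y : ℕ → A) : ℝ := birkhoffSum seqTail Q.pot n y

/-- The sum of `exp (t S_m)` over the points of period `m` with the property `P` is at most `M`. -/
def SumLE (P : (ℕ → A) → Prop) (m : ℕ) (t M : ℝ) : Prop :=
  ∀ F : Finset (ℕ → A), (∀ y ∈ F, y ∈ Q.pts ∧ Function.IsPeriodicPt seqTail m y ∧ P y) →
    ∑ y ∈ F, Real.exp (t * Q.sum m y) ≤ M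

variable {Q}

lemma iterate_mem {y : ℕ → A} (hy : y ∈ Q.pts) (n : ℕ) : seqTail^[n] y ∈ Q.pts := by
  induction n with
  | zero => exact hy
  | succ n ih => rw [Function.iterate_succ_apply']; exact Q.tail_mem _ ih

lemma step_of_mem {y : ℕ → A} (hy : y ∈ Q.pts) (i : ℕ) : Q.step (y i) (y (i + 1)) :=
  ⟨_, iterate_mem hy i, by simp [seqTail_iterate], by simp [seqTail_iterate, add_comm]⟩

lemma isWalk_of_mem {y : ℕ → A} (hy : y ∈ Q.pts) (k n : ℕ) :
    IsWalk Q.step (seqPrefix n (seqTail^[k] y)) (y k) (y (n + k)) := by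
  have := isWalk_seqPrefix (r := Q.step) (step_of_mem (iterate_mem hy k)) n
  simpa [seqTail_iterate] using this

lemma abs_sum_le {y : ℕ → A} (hy : y ∈ Q.pts) (n : ℕ) : |Q.sum n y| ≤ n * Q.B := by
  refine (Finset.abs_sum_le_sum_abs _ _).trans ?_
  refine (Finset.sum_le_sum fun k _ => Q.abs_pot_le _ (iterate_mem hy k)).trans ?_
  simp

/-- Repeat the closed walk periodically: every consecutive pair is a step, also across the seam, so
`glue` applies. -/
lemma exists_mem_of_isWalk {l : List A} {a : A} (hl : l ≠ []) (h : IsWalk Q.step l a a) :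
    ∃ y ∈ Q.pts, Function.IsPeriodicPt seqTail l.length y ∧ seqPrefix l.length y = l := by
  have hpos : 0 < l.length := List.length_pos_iff.2 hl
  let y : ℕ → A := fun j => l[j % l.length]'(Nat.mod_lt _ hpos)
  have hper : Function.IsPeriodicPt seqTail l.length y := by
    rw [isPeriodicPt_seqTail_iff]; intro i; simp [y]
  refine ⟨y, Q.glue y l.length hpos hper fun i => ?_, hper, ?_⟩
  · have h0 : l[0] = a := by
      have := h.2
      cases l with
      | nil => simp at hl
      | cons x l => simpa using this
    have hk : i % l.length < l.length := Nat.mod_lt _ hpos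
    have hch := List.isChain_iff_getElem.1 h.1 (i % l.length) (by simp; omega)
    rw [List.getElem_append_left hk] at hch
    have e : y (i + 1) = (l ++ [a])[i % l.length + 1]'(by simp; omega) := by
      simp only [y]
      by_cases hlt : i % l.length + 1 < l.length
      · rw [List.getElem_append_left hlt]
        congr 1
        rw [Nat.add_mod, Nat.mod_eq_of_lt (a := 1) (by omega), Nat.mod_eq_of_lt hlt]
      · have heq : i % l.length + 1 = l.length := by omega
        have h1 : (i + 1) % l.length = 0 := by
          rw [← Nat.mod_add_mod, heq, Nat.mod_self]
        simp only [h1, heq]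
        simp [h0]
    obtain ⟨z, hz, hz0, hz1⟩ := hch
    exact ⟨z, hz, hz0, hz1.trans e.symm⟩
  · apply List.ext_getElem (by simp)
    intro j h1 h2
    simp only [seqPrefix, List.getElem_map, List.getElem_range, y]
    congr 1
    exact Nat.mod_eq_of_lt h2

lemma sum_mul_period {y : ℕ → A} {m : ℕ}
    (hper : Function.IsPeriodicPt seqTail m y) (k : ℕ) : Q.sum (k * m) y = k * Q.sum m y := by
  induction k with
  | zero => simp [sum]
  | succ k ih =>
    have : seqTail^[k * m] y = y := hper.const_mul k
    rw [sum, Nat.succ_mul, birkhoffSum_add, this, ← sum, ← sum, ih]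
    push_cast; ring

end MarkovPeriodicSystem

/-! ### Cells inside a communicating class. -/

namespace MarkovPeriodicSystem

variable {A : Type*} (Q : MarkovPeriodicSystem A)

/-- The symbols which communicate with `i` in exactly `T₀` steps. -/
def cls (T₀ : ℕ) (i : A) : Set A := {j | Reach Q.step T₀ i j ∧ Reach Q.step T₀ j i}

/-- Words of length `T` which are walks inside the class of `i`. -/
@[ext] structure Cell (T₀ T : ℕ) (i : A) where
  /-- the underlying word -/
  word : List A
  length_word : word.length = T
  exists_isWalk : ∃ a ∈ Q.cls T₀ i, ∃ b ∈ Q.cls T₀ i, IsWalk Q.step word a b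

instance [Finite A] (T₀ T : ℕ) (i : A) : Finite (Q.Cell T₀ T i) := by
  have := (List.finite_length_eq A T).to_subtype
  exact Finite.of_injective
    (fun e : Q.Cell T₀ T i => (⟨e.word, e.length_word⟩ : {l : List A | l.length = T}))
    (fun e f h => Cell.ext (congrArg Subtype.val h))

variable {Q} {T₀ T : ℕ} {i : A}

/-- The second cell can follow the first. -/
def Cell.rel (e f : Q.Cell T₀ T i) : Prop := ∀ b ∈ f.word.head?, (e.word ++ [b]).IsChain Q.step

/-- The word spelled by a list of cells. -/
def Cell.flat (w : List (Q.Cell T₀ T i)) : List A := (w.map Cell.word).flatten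

lemma Cell.flat_append (u v : List (Q.Cell T₀ T i)) :
    Cell.flat (u ++ v) = Cell.flat u ++ Cell.flat v := by simp [flat]

@[simp] lemma Cell.length_flat (w : List (Q.Cell T₀ T i)) : (Cell.flat w).length = w.length * T := by
  induction w with
  | nil => simp [flat]
  | cons e w ih =>
    have : Cell.flat (e :: w) = e.word ++ Cell.flat w := by simp [flat]
    rw [this, List.length_append, ih, e.length_word, List.length_cons]; ring

lemma Cell.flat_injective (hT : 0 < T) :
    Function.Injective (Cell.flat : List (Q.Cell T₀ T i) → List A) := by
  intro u v h
  have hl : u.length = v.length := by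
    have := congrArg List.length h
    rw [length_flat, length_flat] at this
    exact Nat.eq_of_mul_eq_mul_right hT this
  induction u generalizing v with
  | nil => simpa using hl.symm
  | cons e u ih =>
    cases v with
    | nil => simp at hl
    | cons f v =>
      have : e.word ++ Cell.flat u = f.word ++ Cell.flat v := by simpa [flat] using h
      obtain ⟨h1, h2⟩ := List.append_inj this (by rw [e.length_word, f.length_word])
      rw [Cell.ext h1, ih h2 (by simpa using hl)]

/-- Pass through `i`, which takes `2 * T₀` steps, and use idempotence. -/
lemma reach_of_mem_cls (hT₀ : ∀ k, 0 < k → Reach Q.step (k * T₀) = Reach Q.step T₀) {a b : A}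
    (ha : a ∈ Q.cls T₀ i) (hb : b ∈ Q.cls T₀ i) : Reach Q.step T₀ a b := by
  rw [← hT₀ 2 (by norm_num), two_mul]
  exact ha.2.add hb.1

/-- The end vertex is not part of a cell's word, so it may be replaced by the first letter of the
next cell; `Cell.rel` says that this is allowed. -/
lemma Cell.exists_isWalk_flat (hT : 0 < T) (hi : i ∈ Q.cls T₀ i)
    {w : List (Q.Cell T₀ T i)} (hw : w.IsChain Cell.rel) :
    ∃ a ∈ Q.cls T₀ i, ∃ b ∈ Q.cls T₀ i, IsWalk Q.step (Cell.flat w) a b := by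
  induction w with
  | nil => exact ⟨i, hi, i, hi, by simp [flat, IsWalk]⟩
  | cons e w ih =>
    have e1 : Cell.flat (e :: w) = e.word ++ Cell.flat w := by simp [flat]
    obtain ⟨a, ha, b, hb, hwalk⟩ := e.exists_isWalk
    rw [e1]
    cases w with
    | nil => exact ⟨a, ha, b, hb, by simpa [flat] using hwalk⟩
    | cons f w =>
      obtain ⟨hef, hw'⟩ := List.isChain_cons_cons.1 hw
      obtain ⟨c, hc, d, hd, hcd⟩ := ih hw'
      have hf : f.word ≠ [] := by
        intro h; have := f.length_word; rw [h] at this; simp at this; omega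
      have he : e.word ≠ [] := by
        intro h; have := e.length_word; rw [h] at this; simp at this; omega
      have hfc : c ∈ f.word.head? := by
        have := hcd.2
        obtain ⟨x, l, hx⟩ := List.exists_cons_of_ne_nil hf
        simpa [flat, hx] using this
      have hec : IsWalk Q.step e.word a c := by
        refine ⟨hef c hfc, ?_⟩
        have := hwalk.2
        obtain ⟨x, l, hx⟩ := List.exists_cons_of_ne_nil he
        simpa [hx] using this
      exact ⟨a, ha, d, hd, hec.append hcd⟩

/-- A chain of cells extends to a periodic point of the system. -/
lemma Cell.exists_closure (hT0 : 0 < T₀)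
    (hT₀ : ∀ k, 0 < k → Reach Q.step (k * T₀) = Reach Q.step T₀) (hT : 0 < T)
    (hi : i ∈ Q.cls T₀ i) {w : List (Q.Cell T₀ T i)} (hw : w.IsChain Cell.rel) :
    ∃ y ∈ Q.pts, Function.IsPeriodicPt seqTail (w.length * T + T₀) y ∧
      seqPrefix (w.length * T) y = Cell.flat w := by
  obtain ⟨a, ha, b, hb, hwalk⟩ := Cell.exists_isWalk_flat hT hi hw
  obtain ⟨l, hl, hl'⟩ := reach_of_mem_cls hT₀ hb ha
  have hlen : (Cell.flat w ++ l).length = w.length * T + T₀ := by simp [hl]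
  have hne : Cell.flat w ++ l ≠ [] := by
    intro h; rw [h] at hlen; simp at hlen; omega
  obtain ⟨y, hy, hper, hpre⟩ := exists_mem_of_isWalk hne (hwalk.append hl')
  rw [hlen] at hper hpre
  refine ⟨y, hy, hper, ?_⟩
  rw [seqPrefix_add] at hpre
  exact (List.append_inj hpre (by simp)).1

open Classical in
/-- The Birkhoff sum along a chain of cells, for some periodic extension of it. -/
noncomputable def Cell.val (w : List (Q.Cell T₀ T i)) : ℝ :=
  if h : ∃ y ∈ Q.pts, Function.IsPeriodicPt seqTail (w.length * T + T₀) y ∧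
      seqPrefix (w.length * T) y = Cell.flat w then Q.sum (w.length * T) h.choose else 0

lemma Cell.val_nil : Cell.val ([] : List (Q.Cell T₀ T i)) = 0 := by
  rw [val]; split_ifs <;> simp [MarkovPeriodicSystem.sum]

/-- A chain of cells together with the choice of its periodic extension. -/
lemma Cell.exists_val_eq (hT0 : 0 < T₀)
    (hT₀ : ∀ k, 0 < k → Reach Q.step (k * T₀) = Reach Q.step T₀) (hT : 0 < T)
    (hi : i ∈ Q.cls T₀ i) {w : List (Q.Cell T₀ T i)} (hw : w.IsChain Cell.rel) :
    ∃ y ∈ Q.pts, Function.IsPeriodicPt seqTail (w.length * T + T₀) y ∧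
      seqPrefix (w.length * T) y = Cell.flat w ∧ Cell.val w = Q.sum (w.length * T) y := by
  have h := Cell.exists_closure hT0 hT₀ hT hi hw
  refine ⟨h.choose, h.choose_spec.1, h.choose_spec.2.1, h.choose_spec.2.2, ?_⟩
  rw [val, dif_pos h]

lemma Cell.abs_val_sub_le (hT0 : 0 < T₀)
    (hT₀ : ∀ k, 0 < k → Reach Q.step (k * T₀) = Reach Q.step T₀) (hT : 0 < T)
    (hi : i ∈ Q.cls T₀ i) {w : List (Q.Cell T₀ T i)} (hw : w.IsChain Cell.rel) {z : ℕ → A}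
    (hz : z ∈ Q.pts) (hzw : seqPrefix (w.length * T) z = Cell.flat w) :
    |Cell.val w - Q.sum (w.length * T) z| ≤ Q.K := by
  obtain ⟨y, hy, -, hpre, hval⟩ := Cell.exists_val_eq hT0 hT₀ hT hi hw
  rw [hval]
  exact Q.distortion y hy z hz _ (seqPrefix_eq_iff.1 (hpre.trans hzw.symm))

/-- One periodic extension of `u ++ v` serves both pieces. Each then differs from its own chosen
extension by at most the distortion constant. -/
lemma Cell.abs_val_append_sub_le (hT0 : 0 < T₀)
    (hT₀ : ∀ k, 0 < k → Reach Q.step (k * T₀) = Reach Q.step T₀) (hT : 0 < T)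
    (hi : i ∈ Q.cls T₀ i) (u v : List (Q.Cell T₀ T i)) (huv : (u ++ v).IsChain Cell.rel) :
    |Cell.val (u ++ v) - Cell.val u - Cell.val v| ≤ 2 * Q.K := by
  obtain ⟨y, hy, -, hpre, hval⟩ := Cell.exists_val_eq hT0 hT₀ hT hi huv
  rw [List.length_append, add_mul, seqPrefix_add, flat_append] at hpre
  obtain ⟨h1, h2⟩ := List.append_inj hpre (by simp)
  have h3 := abs_le.1 (Cell.abs_val_sub_le hT0 hT₀ hT hi huv.left_of_append hy h1)
  have h4 := abs_le.1 (Cell.abs_val_sub_le hT0 hT₀ hT hi huv.right_of_append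
    (iterate_mem hy _) h2)
  rw [hval, List.length_append, add_mul, MarkovPeriodicSystem.sum, birkhoffSum_add]
  rw [MarkovPeriodicSystem.sum] at h3 h4
  rw [abs_le]
  constructor <;> linarith

/-- The full period sum of the extension is nonpositive, so only the closing segment of `T₀` steps
can matter. -/
lemma Cell.val_le (hT0 : 0 < T₀)
    (hT₀ : ∀ k, 0 < k → Reach Q.step (k * T₀) = Reach Q.step T₀) (hT : 0 < T)
    (hi : i ∈ Q.cls T₀ i) (w : List (Q.Cell T₀ T i)) (hw : w.IsChain Cell.rel) :
    Cell.val w ≤ T₀ * Q.B := by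
  obtain ⟨y, hy, hper, hpre, hval⟩ := Cell.exists_val_eq hT0 hT₀ hT hi hw
  have h1 := Q.sum_nonpos y hy _ hper
  rw [birkhoffSum_add] at h1
  have h2 := abs_le.1 (abs_sum_le (iterate_mem hy (w.length * T)) T₀)
  rw [MarkovPeriodicSystem.sum] at h2
  rw [hval, MarkovPeriodicSystem.sum]
  linarith

lemma mem_cls_of_mem (hT₀ : ∀ k, 0 < k → Reach Q.step (k * T₀) = Reach Q.step T₀) {y : ℕ → A}
    (hy : y ∈ Q.pts) (hyi : y 0 = i) (k : ℕ) : y (k * T₀) ∈ Q.cls T₀ i := by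
  obtain ⟨m, hm, hper⟩ := Q.exists_period y hy
  have hp : Function.Periodic y m := isPeriodicPt_seqTail_iff.1 hper
  have hr : ∀ k n, Reach Q.step n (y k) (y (n + k)) := fun k n =>
    ⟨_, by simp, isWalk_of_mem hy k n⟩
  constructor
  -- Adding `m` leaves the endpoint unchanged and makes the multiplier positive even for `k = 0`.
  · rw [← hT₀ (k + m) (by omega), ← hyi]
    have h := hr 0 ((k + m) * T₀)
    have e : y ((k + m) * T₀ + 0) = y (k * T₀) := by
      rw [add_zero, add_mul, mul_comm m T₀]
      exact hp.nat_mul T₀ _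
    rwa [e] at h
  -- Together with the `k * T₀` steps already made this is `(k + 1) * T₀` full periods, hence a
  -- return to `y 0`.
  · rw [← hT₀ ((m - 1) * k + m) (by omega), ← hyi]
    have h := hr (k * T₀) (((m - 1) * k + m) * T₀)
    have e : y (((m - 1) * k + m) * T₀ + k * T₀) = y 0 := by
      obtain ⟨p, rfl⟩ : ∃ p, m = p + 1 := ⟨m - 1, by omega⟩
      have : ((p + 1 - 1) * k + (p + 1)) * T₀ + k * T₀ = 0 + ((k + 1) * T₀) * (p + 1) := by
        simp only [Nat.add_sub_cancel]; ring
      rw [this]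
      exact hp.nat_mul _ _
    rwa [e] at h

/-- The initial words of a periodic point through `i` decompose into cells. -/
lemma Cell.exists_flat_eq (hT₀ : ∀ k, 0 < k → Reach Q.step (k * T₀) = Reach Q.step T₀) {p : ℕ}
    {y : ℕ → A} (hy : y ∈ Q.pts) (hyi : y 0 = i) (n : ℕ) :
    ∃ w : List (Q.Cell T₀ (p * T₀) i), w.IsChain Cell.rel ∧ w.length = n ∧
      Cell.flat w = seqPrefix (n * (p * T₀)) y := by
  have hcell : ∀ k, (seqPrefix (p * T₀) (seqTail^[k * (p * T₀)] y)).length = p * T₀ ∧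
      ∃ a ∈ Q.cls T₀ i, ∃ b ∈ Q.cls T₀ i,
        IsWalk Q.step (seqPrefix (p * T₀) (seqTail^[k * (p * T₀)] y)) a b := by
    intro k
    refine ⟨by simp, _, ?_, _, ?_, isWalk_of_mem hy _ _⟩
    · rw [← mul_assoc]; exact mem_cls_of_mem hT₀ hy hyi _
    · rw [← mul_assoc, ← add_mul]; exact mem_cls_of_mem hT₀ hy hyi _
  let c : ℕ → Q.Cell T₀ (p * T₀) i := fun k => ⟨_, (hcell k).1, (hcell k).2⟩
  refine ⟨(List.range n).map c, ?_, by simp, ?_⟩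
  · rw [List.isChain_iff_getElem]
    intro k hk b hb
    simp only [List.getElem_map, List.getElem_range, c] at hb ⊢
    have h := (isWalk_of_mem hy (k * (p * T₀)) (p * T₀)).1
    have e : b = y (p * T₀ + k * (p * T₀)) := by
      have h2 : (seqPrefix (p * T₀) (seqTail^[(k + 1) * (p * T₀)] y)).head? = some b := hb
      revert h2
      generalize p * T₀ = q
      intro h2
      cases q with
      | zero => simp [seqPrefix] at h2
      | succ q =>
        simp only [seqPrefix, List.range_succ_eq_map, List.map_cons, List.head?_cons,
          Option.some.injEq, seqTail_iterate] at h2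
        rw [← h2]; congr 1; ring
    rw [e]; exact h
  · induction n with
    | zero => simp [flat, seqPrefix]
    | succ n ih =>
      rw [List.range_succ, List.map_append, flat_append, ih, Nat.succ_mul, seqPrefix_add]
      simp [flat, c]

end MarkovPeriodicSystem

/-! ### Markers, and comparison of chain sums with sums over periodic points. -/

namespace MarkovPeriodicSystem

variable {A : Type*} {Q : MarkovPeriodicSystem A} {T₀ T : ℕ} {i : A}

lemma Cell.rel_of_isWalk {e f : Q.Cell T₀ T i} {a b c : A} (h₁ : IsWalk Q.step e.word a b)
    (h₂ : IsWalk Q.step f.word b c) : e.rel f := by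
  intro x hx
  rw [h₂.eq_of_mem_head? hx]
  exact h₁.1

lemma abs_sum_sub_le {y : ℕ → A} (hy : y ∈ Q.pts) {m n : ℕ} (hmn : m ≤ n) :
    |Q.sum n y - Q.sum m y| ≤ (n - m) * Q.B := by
  obtain ⟨k, rfl⟩ := Nat.exists_eq_add_of_le hmn
  have := abs_sum_le (iterate_mem hy m) k
  rw [MarkovPeriodicSystem.sum, birkhoffSum_add]
  simpa using this

/-- If some point through `i` has a negative period sum, then for suitable cell lengths there are
cells, with arbitrarily negative value, which connect any cell with any other. -/
lemma exists_markers (hT0 : 0 < T₀)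
    (hT₀ : ∀ k, 0 < k → Reach Q.step (k * T₀) = Reach Q.step T₀) {y : ℕ → A} (hy : y ∈ Q.pts)
    (hyi : y 0 = i) {m : ℕ} (hper : Function.IsPeriodicPt seqTail m y) (hneg : Q.sum m y < 0)
    (X : ℝ) : ∃ p > 0, ∃ mk : Q.Cell T₀ (p * T₀) i → Q.Cell T₀ (p * T₀) i → Q.Cell T₀ (p * T₀) i,
      (∀ e f, Cell.rel e (mk e f)) ∧ (∀ e f, Cell.rel (mk e f) f) ∧
        ∀ e f, Cell.val [mk e f] < X := by
  have hi : i ∈ Q.cls T₀ i := by simpa [hyi] using mem_cls_of_mem hT₀ hy hyi 0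
  -- Enough turns round the negative orbit to outweigh two connecting walks of length `T₀` and one
  -- distortion error.
  obtain ⟨k, hk⟩ : ∃ k : ℕ, (k : ℝ) * (T₀ * Q.sum m y) + (2 * T₀ * Q.B + Q.K) < X := by
    have h1 : (0 : ℝ) < -(T₀ * Q.sum m y) := by
      have : (0 : ℝ) < T₀ := by exact_mod_cast hT0
      nlinarith
    obtain ⟨k, hk⟩ := exists_nat_gt ((2 * T₀ * Q.B + Q.K - X) / -(T₀ * Q.sum m y))
    rw [div_lt_iff₀ h1] at hk
    exact ⟨k, by linarith⟩
  -- One stretch of `T₀` steps to reach `i`, `k * m` of them round the orbit of `y`, and one to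
  -- leave `i`.
  refine ⟨k * m + 2, by omega, ?_⟩
  have key : ∀ e f : Q.Cell T₀ ((k * m + 2) * T₀) i, ∃ q : Q.Cell T₀ ((k * m + 2) * T₀) i,
      Cell.rel e q ∧ Cell.rel q f ∧ Cell.val [q] < X := by
    intro e f
    obtain ⟨a, ha, b, hb, he⟩ := e.exists_isWalk
    obtain ⟨c, hc, d, hd, hf⟩ := f.exists_isWalk
    obtain ⟨l₁, hl₁, h₁⟩ := reach_of_mem_cls hT₀ hb hi
    obtain ⟨l₃, hl₃, h₃⟩ := reach_of_mem_cls hT₀ hi hc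
    have h₂ : IsWalk Q.step (seqPrefix (k * m * T₀) y) i i := by
      have h := isWalk_of_mem hy 0 (k * m * T₀)
      have e1 : y (k * m * T₀ + 0) = y 0 := by
        have := (isPeriodicPt_seqTail_iff.1 (hper.const_mul (T₀ * k))) 0
        rw [← this]; congr 1; ring
      rw [e1, hyi] at h
      exact h
    have hlen : (l₁ ++ (seqPrefix (k * m * T₀) y ++ l₃)).length = (k * m + 2) * T₀ := by
      simp [hl₁, hl₃]; ring
    have hwalk := h₁.append (h₂.append h₃)
    let q : Q.Cell T₀ ((k * m + 2) * T₀) i := ⟨_, hlen, b, hb, c, hc, hwalk⟩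
    refine ⟨q, Cell.rel_of_isWalk he hwalk, Cell.rel_of_isWalk hwalk hf, ?_⟩
    obtain ⟨z, hz, -, hpre, hval⟩ := Cell.exists_val_eq hT0 hT₀ (by positivity) hi
      (w := [q]) (by simp)
    have e1 : [q].length * ((k * m + 2) * T₀) = T₀ + (k * m * T₀ + T₀) := by
      simp; ring
    rw [e1] at hpre hval
    have e2 : Cell.flat [q] = l₁ ++ (seqPrefix (k * m * T₀) y ++ l₃) := by simp [Cell.flat, q]
    rw [e2, seqPrefix_add, seqPrefix_add] at hpre
    have hpre2 := (List.append_inj (List.append_inj hpre (by simp [hl₁])).2 (by simp)).1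
    have d1 := (abs_le.1 (Q.distortion _ (iterate_mem hz T₀) y hy _ (seqPrefix_eq_iff.1 hpre2))).2
    have d2 := (abs_le.1 (abs_sum_le hz T₀)).2
    have d3 := (abs_le.1 (abs_sum_le (iterate_mem (iterate_mem hz T₀) (k * m * T₀)) T₀)).2
    have d4 : Q.sum (k * m * T₀) y = k * (T₀ * Q.sum m y) := by
      have := sum_mul_period (Q := Q) hper (k * T₀)
      rw [show k * m * T₀ = k * T₀ * m by ring, this]; push_cast; ring
    rw [hval, MarkovPeriodicSystem.sum, birkhoffSum_add, birkhoffSum_add]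
    rw [MarkovPeriodicSystem.sum] at d2 d3 d4
    linarith
  choose mk h1 h2 h3 using key
  exact ⟨mk, h1, h2, h3⟩

/-- The chain sums of cells are bounded by the sums over periodic points. -/
lemma sum_chains_le_of_sumLE [Finite A] (hT0 : 0 < T₀)
    (hT₀ : ∀ k, 0 < k → Reach Q.step (k * T₀) = Reach Q.step T₀) (hT : 0 < T)
    (hi : i ∈ Q.cls T₀ i) {t : ℝ} (ht : 0 ≤ t) {n : ℕ} {M : ℝ}
    (h : Q.SumLE (fun _ => True) (n * T + T₀) t M) :
    ∑ w ∈ chains (Cell.rel (Q := Q) (T₀ := T₀) (T := T) (i := i)) n, Real.exp (t * Cell.val w) ≤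
      Real.exp (t * (T₀ * Q.B)) * M := by
  classical
  have key : ∀ w : List (Q.Cell T₀ T i), ∃ y : ℕ → A, w.IsChain Cell.rel → y ∈ Q.pts ∧
      Function.IsPeriodicPt seqTail (w.length * T + T₀) y ∧
      seqPrefix (w.length * T) y = Cell.flat w ∧ Cell.val w = Q.sum (w.length * T) y := by
    intro w
    by_cases hw : w.IsChain Cell.rel
    · obtain ⟨y, hy⟩ := Cell.exists_val_eq hT0 hT₀ hT hi hw
      exact ⟨y, fun _ => hy⟩
    · exact ⟨fun _ => i, fun h => absurd h hw⟩
  choose y hy using key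
  have hinj : Set.InjOn y (chains (Cell.rel (Q := Q) (T₀ := T₀) (T := T) (i := i)) n) := by
    intro u hu v hv huv
    obtain ⟨hul, huc⟩ := mem_chains.1 hu
    obtain ⟨hvl, hvc⟩ := mem_chains.1 hv
    apply Cell.flat_injective hT
    rw [← (hy u huc).2.2.1, ← (hy v hvc).2.2.1, hul, hvl, huv]
  have hF := h ((chains (Cell.rel (Q := Q) (T₀ := T₀) (T := T) (i := i)) n).image y) (by
    intro z hz
    obtain ⟨w, hw, rfl⟩ := Finset.mem_image.1 hz
    obtain ⟨hwl, hwc⟩ := mem_chains.1 hw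
    have := hy w hwc
    rw [hwl] at this
    exact ⟨this.1, this.2.1, trivial⟩)
  rw [Finset.sum_image hinj] at hF
  refine le_trans ?_ (mul_le_mul_of_nonneg_left hF (Real.exp_pos _).le)
  rw [Finset.mul_sum]
  refine Finset.sum_le_sum fun w hw => ?_
  obtain ⟨hwl, hwc⟩ := mem_chains.1 hw
  obtain ⟨hyp, -, -, hval⟩ := hy w hwc
  rw [← Real.exp_add]
  apply Real.exp_le_exp.2
  rw [hval, hwl, ← mul_add]
  refine mul_le_mul_of_nonneg_left ?_ ht
  have := (abs_le.1 (abs_sum_sub_le hyp (Nat.le_add_right (n * T) T₀))).1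
  push_cast at this
  linarith

/-- The sums over the periodic points through `i` are bounded by chain sums of cells. -/
lemma sumLE_of_sum_chains_le [Finite A] (hT0 : 0 < T₀)
    (hT₀ : ∀ k, 0 < k → Reach Q.step (k * T₀) = Reach Q.step T₀) {p : ℕ} (hp : 0 < p)
    (hi : i ∈ Q.cls T₀ i) {t : ℝ} (ht : 0 ≤ t) {m : ℕ} (hm : 0 < m) {M : ℝ}
    (h : ∑ w ∈ chains (Cell.rel (Q := Q) (T₀ := T₀) (T := p * T₀) (i := i)) (m / (p * T₀) + 1),
      Real.exp (t * Cell.val w) ≤ M) :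
    Q.SumLE (fun y => y 0 = i) m t (Real.exp (t * (Q.K + (p * T₀ : ℕ) * Q.B)) * M) := by
  classical
  intro F hF
  have hT : 0 < p * T₀ := by positivity
  -- Enough cells to cover a whole period, so that the chain determines the point; the overshoot is
  -- at most one cell.
  set n := m / (p * T₀) + 1 with hn
  have hmn : m ≤ n * (p * T₀) := by
    rw [hn, mul_comm]; exact (Nat.lt_mul_div_succ m hT).le
  have hnm : n * (p * T₀) ≤ m + p * T₀ := by
    rw [hn, Nat.succ_mul]; exact Nat.add_le_add_right (Nat.div_mul_le_self _ _) _
  have key : ∀ y : ℕ → A, ∃ w : List (Q.Cell T₀ (p * T₀) i), y ∈ F → w.IsChain Cell.rel ∧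
      w.length = n ∧ Cell.flat w = seqPrefix (n * (p * T₀)) y := by
    intro y
    by_cases hy : y ∈ F
    · obtain ⟨w, hw⟩ := Cell.exists_flat_eq hT₀ (p := p) (hF y hy).1 (hF y hy).2.2 n
      exact ⟨w, fun _ => hw⟩
    · exact ⟨[], fun h => absurd h hy⟩
  choose w hw using key
  have hinj : Set.InjOn w F := by
    intro y hy z hz hyz
    have h1 : seqPrefix (n * (p * T₀)) y = seqPrefix (n * (p * T₀)) z := by
      rw [← (hw y hy).2.2, ← (hw z hz).2.2, hyz]
    refine eq_of_seqPrefix_eq hm (hF y hy).2.1 (hF z hz).2.1 ?_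
    rw [seqPrefix_eq_iff] at h1 ⊢
    exact fun j hj => h1 j (hj.trans_le hmn)
  refine le_trans ?_ (mul_le_mul_of_nonneg_left h (Real.exp_pos _).le)
  have hsub : F.image w ⊆ chains Cell.rel n := by
    intro z hz
    obtain ⟨y, hy, rfl⟩ := Finset.mem_image.1 hz
    exact mem_chains.2 ⟨(hw y hy).2.1, (hw y hy).1⟩
  refine le_trans ?_ (mul_le_mul_of_nonneg_left (Finset.sum_le_sum_of_subset_of_nonneg hsub
    (fun _ _ _ => (Real.exp_pos _).le)) (Real.exp_pos _).le)
  rw [Finset.sum_image hinj, Finset.mul_sum]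
  refine Finset.sum_le_sum fun y hy => ?_
  obtain ⟨hyp, -, -⟩ := hF y hy
  obtain ⟨hwc, hwl, hwf⟩ := hw y hy
  rw [← Real.exp_add, ← mul_add]
  refine Real.exp_le_exp.2 (mul_le_mul_of_nonneg_left ?_ ht)
  have h1 := Cell.abs_val_sub_le hT0 hT₀ hT hi hwc hyp (by rw [hwl, hwf])
  rw [hwl] at h1
  have h2 := (abs_le.1 h1).1
  have h3 := (abs_le.1 (abs_sum_sub_le hyp hmn)).1
  have hB : 0 ≤ Q.B := (abs_nonneg _).trans (Q.abs_pot_le y hyp)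
  have h4 : ((n * (p * T₀) : ℕ) : ℝ) - m ≤ (p * T₀ : ℕ) := by
    rw [sub_le_iff_le_add']; exact_mod_cast hnm
  have h5 := mul_le_mul_of_nonneg_right h4 hB
  linarith

end MarkovPeriodicSystem

/-! ### The dichotomy for each symbol and the contradiction. -/

namespace MarkovPeriodicSystem

variable {A : Type*} {Q : MarkovPeriodicSystem A} {i : A}

/-- `log (1 + x)` is at least `2 x / (x + 2)`, of order `exp (-a t)`, while `g t < exp (-(a + 1) t)`
is smaller by a further factor `exp (-t)`. -/
lemma eventually_mul_lt_log_one_add {g : ℝ → ℝ} (hg : ∀ a, ∀ᶠ t in atTop, g t < Real.exp (-a * t))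
    {T : ℝ} (hT : 0 < T) (a b : ℝ) (ha : 0 ≤ a) :
    ∀ᶠ t in atTop, T * (2 * g t) < Real.log (1 + Real.exp (-(t * a + b))) := by
  have hlim : Tendsto (fun t : ℝ => Real.exp (-t) * (T * (Real.exp (-b) + 2))) atTop (nhds 0) := by
    simpa using Real.tendsto_exp_neg_atTop_nhds_zero.mul_const (T * (Real.exp (-b) + 2))
  filter_upwards [hg (a + 1), hlim.eventually_lt_const (Real.exp_pos (-b)), eventually_ge_atTop 0]
    with t h1 h2 ht
  set x := Real.exp (-(t * a + b)) with hx
  have hx0 : 0 < x := Real.exp_pos _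
  refine lt_of_lt_of_le ?_ (Real.le_log_one_add_of_nonneg hx0.le)
  rw [lt_div_iff₀ (by positivity)]
  have hxb : x ≤ Real.exp (-b) := by
    apply Real.exp_le_exp.2; nlinarith [mul_nonneg ht ha]
  have e1 : x = Real.exp (-(t * a)) * Real.exp (-b) := by rw [hx, ← Real.exp_add]; ring_nf
  have e2 : Real.exp (-(a + 1) * t) = Real.exp (-(t * a)) * Real.exp (-t) := by
    rw [← Real.exp_add]; ring_nf
  calc T * (2 * g t) * (x + 2)
      < T * (2 * Real.exp (-(a + 1) * t)) * (x + 2) := by gcongr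
    _ ≤ T * (2 * Real.exp (-(a + 1) * t)) * (Real.exp (-b) + 2) := by gcongr
    _ = 2 * Real.exp (-(t * a)) * (Real.exp (-t) * (T * (Real.exp (-b) + 2))) := by rw [e2]; ring
    _ ≤ 2 * Real.exp (-(t * a)) * Real.exp (-b) := by gcongr
    _ = 2 * x := by rw [e1]; ring

/-- If the growth rate `b + g t` of the period sums approaches its limit faster than any exponential,
then the growth rate of the sums over the points through a given symbol is smaller. -/
lemma eventually_exists_rate_lt [Finite A] {b : ℝ} {g : ℝ → ℝ} (hg0 : ∀ᶠ t in atTop, 0 < g t)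
    (hg : ∀ a, ∀ᶠ t in atTop, g t < Real.exp (-a * t))
    (hub : ∀ᶠ t in atTop, ∀ θ > b + g t, ∀ᶠ m : ℕ in atTop,
      Q.SumLE (fun _ => True) m t (Real.exp (m * θ))) (i : A) :
    ∀ᶠ t in atTop, ∃ θ < b + g t, ∃ c, ∀ᶠ m : ℕ in atTop,
      Q.SumLE (fun y => y 0 = i) m t (c * Real.exp (m * θ)) := by
  -- In the first case the weights do not depend on `t`, so the upper bound at a later `t'` with `g
  -- t' < g t` can be used at `t`.
  by_cases h0 : ∀ y ∈ Q.pts, y 0 = i → ∀ m, Function.IsPeriodicPt seqTail m y → Q.sum m y = 0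
  · have hg1 : Tendsto g atTop (nhds 0) := by
      refine squeeze_zero' (hg0.mono fun _ h => h.le) ((hg 1).mono fun _ h => h.le) ?_
      simpa using Real.tendsto_exp_neg_atTop_nhds_zero
    filter_upwards [hg0] with t ht
    obtain ⟨t', h1, h2⟩ := (hub.and (hg1.eventually_lt_const ht)).exists
    obtain ⟨θ, hθ1, hθ2⟩ := exists_between (add_lt_add_right h2 b)
    refine ⟨θ, hθ2, 1, ?_⟩
    filter_upwards [h1 θ hθ1] with m hm F hF
    rw [one_mul]
    refine le_trans (le_of_eq ?_) (hm F fun y hy => ⟨(hF y hy).1, (hF y hy).2.1, trivial⟩)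
    refine Finset.sum_congr rfl fun y hy => ?_
    rw [h0 y (hF y hy).1 (hF y hy).2.2 m (hF y hy).2.1]
    simp
  · push Not at h0
    obtain ⟨y, hy, hyi, m, hper, hne⟩ := h0
    have hneg : Q.sum m y < 0 := lt_of_le_of_ne (Q.sum_nonpos y hy m hper) hne
    have hB : 0 ≤ Q.B := (abs_nonneg _).trans (Q.abs_pot_le y hy)
    have hK : 0 ≤ Q.K := (abs_nonneg _).trans (Q.distortion y hy y hy 0 (by simp))
    obtain ⟨T₀, hT0, hT₀⟩ := exists_reach_mul_eq Q.step
    have hi : i ∈ Q.cls T₀ i := by simpa [hyi] using mem_cls_of_mem hT₀ hy hyi 0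
    set C : ℝ := T₀ * Q.B with hC
    have hC0 : 0 ≤ C := by positivity
    -- Chain values are almost additive with constant `2 * Q.K`, which plays the role of `K` in the
    -- chain lemmas.
    set D : ℝ := C + 2 * (2 * Q.K) + 1 with hD
    obtain ⟨p, hp, hmk⟩ := exists_markers hT0 hT₀ hy hyi hper hneg
      (-(D + 2 * C + 2 * (2 * Q.K)))
    set T := p * T₀ with hTdef
    obtain ⟨mk, hmk1, hmk2, hmk3⟩ := hmk
    have hT : 0 < T := by positivity
    have hTR : (0 : ℝ) < T := by exact_mod_cast hT
    have hadd := Cell.abs_val_append_sub_le (T := T) hT0 hT₀ hT hi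
    have hle := Cell.val_le (T := T) hT0 hT₀ hT hi
    have hnil : Cell.val ([] : List (Q.Cell T₀ T i)) = 0 := Cell.val_nil
    -- The dichotomy on the number of good chains; a cell has `T` symbols, so the critical rate per
    -- cell is `T * b`.
    by_cases hN : ∃ L : ℕ, 1 ≤ L ∧
        ((goodChains (Cell.rel (Q := Q) (T₀ := T₀) (T := T) (i := i)) Cell.val D L).card : ℝ) <
          Real.exp (L * (T * b))
    · obtain ⟨L, hL, hN⟩ := hN
      filter_upwards [exists_rate_lt_of_card_goodChains_lt hadd hle le_rfl hL hN, hg0,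
        eventually_ge_atTop 0] with t h1 h2 ht
      obtain ⟨θ, hθ, c, hc⟩ := h1
      have hc0 : 0 ≤ c := by
        have := (Finset.sum_nonneg fun _ _ => (Real.exp_pos _).le).trans (hc 0)
        simpa using this
      refine ⟨θ / T, ?_, Real.exp (t * (Q.K + T * Q.B)) * (c * Real.exp |θ|), ?_⟩
      · have : θ / T < b := by rw [div_lt_iff₀ hTR]; linarith
        linarith
      · filter_upwards [eventually_gt_atTop 0] with m hm F hF
        refine (sumLE_of_sum_chains_le hT0 hT₀ hp hi ht hm (hc _) F hF).trans ?_
        rw [mul_assoc, mul_assoc c, ← Real.exp_add]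
        refine mul_le_mul_of_nonneg_left (mul_le_mul_of_nonneg_left
          (Real.exp_le_exp.2 ?_) hc0) (Real.exp_pos _).le
        have e : (m : ℝ) = T * (m / T : ℕ) + (m % T : ℕ) := by
          exact_mod_cast (Nat.div_add_mod m T).symm
        have hr : ((m % T : ℕ) : ℝ) ≤ T := by exact_mod_cast (Nat.mod_lt m hT).le
        have e2 : (m : ℝ) * (θ / T) = (m / T : ℕ) * θ + (m % T : ℕ) / T * θ := by
          rw [e]; field_simp
        rw [e2]
        push_cast
        have h3 : ((m % T : ℕ) : ℝ) / T ≤ 1 := by rw [div_le_one hTR]; exact hr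
        have h4 : 0 ≤ ((m % T : ℕ) : ℝ) / T := by positivity
        nlinarith [le_abs_self θ, neg_abs_le θ]
    · exfalso
      push Not at hN
      have hN' : ∀ n : ℕ, Real.exp (n * (T * b)) ≤
          (goodChains (Cell.rel (Q := Q) (T₀ := T₀) (T := T) (i := i)) Cell.val D n).card := by
        intro n
        rcases Nat.eq_zero_or_pos n with rfl | hn
        · have : [] ∈ goodChains (Cell.rel (Q := Q) (T₀ := T₀) (T := T) (i := i)) Cell.val D 0 := by
            rw [mem_goodChains, hnil]
            refine ⟨by simp, ?_⟩
            simp only [neg_le_iff_add_nonneg, hD]; positivity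
          simp only [Nat.cast_zero, zero_mul, Real.exp_zero]
          exact_mod_cast Finset.card_pos.2 ⟨_, this⟩
        · exact hN n hn
      have hne : Nonempty (Q.Cell T₀ T i) := by
        obtain ⟨w, -, hw, -⟩ := Cell.exists_flat_eq hT₀ (p := p) hy hyi 1
        cases w with
        | nil => simp at hw
        | cons e w => exact ⟨e⟩
      obtain ⟨a, ha, hlow⟩ := le_sum_chains_of_markers hnil hadd hle hN' mk hmk1 hmk2 hmk3
      obtain ⟨t, ⟨⟨h1, h2⟩, h3⟩, ht⟩ := (((hub.and hg0).and
        (eventually_mul_lt_log_one_add hg hTR a (T * b) ha)).and (eventually_ge_atTop 0)).exists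
      obtain ⟨c, hc, hlow⟩ := hlow t ht
      set κ := Real.log (1 + Real.exp (-(t * a + T * b))) with hκ
      -- The upper bound needs a rate strictly above `b + g t`; the marker gain `κ` still beats `T *
      -- (2 * g t)`.
      have h4 := h1 (b + 2 * g t) (by linarith)
      have h5 : Tendsto (fun n : ℕ => n * T + T₀) atTop atTop :=
        tendsto_atTop_mono
        (fun n => (Nat.le_mul_of_pos_right n hT).trans (Nat.le_add_right _ _)) tendsto_id
      have h6 : ∀ᶠ n : ℕ in atTop, c * Real.exp (n * (κ - T * (2 * g t))) ≤
          Real.exp (t * C) * Real.exp (T₀ * (b + 2 * g t)) := by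
        filter_upwards [h5.eventually h4] with n hn
        have h7 := (hlow n).trans (sum_chains_le_of_sumLE hT0 hT₀ hT hi ht hn)
        have e1 : Real.exp (n * (T * b + κ)) = Real.exp (n * (κ - T * (2 * g t))) *
            Real.exp (n * T * (b + 2 * g t)) := by rw [← Real.exp_add]; ring_nf
        have e2 : Real.exp ((n * T + T₀ : ℕ) * (b + 2 * g t)) =
            Real.exp (T₀ * (b + 2 * g t)) * Real.exp (n * T * (b + 2 * g t)) := by
          rw [← Real.exp_add]; push_cast; ring_nf
        rw [e1, e2, ← mul_assoc c, ← mul_assoc (Real.exp (t * _))] at h7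
        exact le_of_mul_le_mul_right h7 (Real.exp_pos _)
      have h8 : Tendsto (fun n : ℕ => c * Real.exp (n * (κ - T * (2 * g t)))) atTop atTop := by
        refine Tendsto.const_mul_atTop hc (Real.tendsto_exp_atTop.comp ?_)
        exact tendsto_natCast_atTop_atTop.atTop_mul_const (by linarith)
      obtain ⟨n, h9, h10⟩ := (h6.and (h8.eventually_gt_atTop _)).exists
      exact absurd h9 (not_le.2 h10)

lemma sumLE_of_forall_sumLE [Fintype A] {m : ℕ} {t : ℝ} {M : A → ℝ}
    (h : ∀ i, Q.SumLE (fun y => y 0 = i) m t (M i)) :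
    Q.SumLE (fun _ => True) m t (∑ i, M i) := by
  classical
  intro F hF
  rw [← Finset.sum_fiberwise F (fun y => y 0)]
  refine Finset.sum_le_sum fun i _ => h i _ fun y hy => ?_
  rw [Finset.mem_filter] at hy
  exact ⟨(hF y hy.1).1, (hF y hy.1).2.1, hy.2⟩

/-- The growth rate of the period sums cannot approach its limit from above faster than any
exponential. -/
theorem not_superexponential_rate (Q : MarkovPeriodicSystem A) [Finite A] [Nonempty A] {b : ℝ} {g : ℝ → ℝ}
    (hg0 : ∀ᶠ t in atTop, 0 < g t) (hg : ∀ a, ∀ᶠ t in atTop, g t < Real.exp (-a * t))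
    (hub : ∀ᶠ t in atTop, ∀ θ > b + g t, ∀ᶠ m : ℕ in atTop,
      Q.SumLE (fun _ => True) m t (Real.exp (m * θ)))
    (hlb : ∀ᶠ t in atTop, ∀ θ < b + g t, ¬ ∀ᶠ m : ℕ in atTop,
      Q.SumLE (fun _ => True) m t (Real.exp (m * θ))) : False := by
  cases nonempty_fintype A
  obtain ⟨t, h1, h2⟩ :=
    ((eventually_all.2 (eventually_exists_rate_lt hg0 hg hub)).and hlb).exists
  choose θ hθ c hc using h1
  obtain ⟨i₀, -, hi₀⟩ := Finset.exists_max_image Finset.univ θ Finset.univ_nonempty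
  obtain ⟨θ', hθ1, hθ2⟩ := exists_between (hθ i₀)
  refine h2 θ' hθ2 ?_
  have h8 : Tendsto (fun m : ℕ => Real.exp (m * (θ' - θ i₀))) atTop atTop :=
    Real.tendsto_exp_atTop.comp (tendsto_natCast_atTop_atTop.atTop_mul_const (by linarith))
  filter_upwards [eventually_all.2 hc, h8.eventually_ge_atTop (∑ i, |c i|)] with m hm hlarge F hF
  refine (sumLE_of_forall_sumLE hm F hF).trans ?_
  calc ∑ i, c i * Real.exp (m * θ i) ≤ ∑ i, |c i| * Real.exp (m * θ i₀) := by
        refine Finset.sum_le_sum fun i _ => mul_le_mul (le_abs_self _) (Real.exp_le_exp.2 ?_)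
          (Real.exp_pos _).le (abs_nonneg _)
        exact mul_le_mul_of_nonneg_left (hi₀ i (Finset.mem_univ i)) (Nat.cast_nonneg _)
    _ = (∑ i, |c i|) * Real.exp (m * θ i₀) := by rw [Finset.sum_mul]
    _ ≤ Real.exp (m * (θ' - θ i₀)) * Real.exp (m * θ i₀) :=
        mul_le_mul_of_nonneg_right hlarge (Real.exp_pos _).le
    _ = Real.exp (m * θ') := by rw [← Real.exp_add]; ring_nf

end MarkovPeriodicSystem

/-! ### Pressure and sums over periodic points. -/

section PressureBounds

variable {Λ G : Type} [TopologicalSpace Λ] [AddMonoidWithOne G] {X : Subshift Λ G}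
  {φ : X.carrier → ℝ}

lemma log_ofReal_exp_eq (m : ℕ) (θ : ℝ) :
    ENNReal.log (ENNReal.ofReal (Real.exp (m * θ))) = ((m : ℝ) : EReal) * (θ : EReal) := by
  rw [ENNReal.log_ofReal_of_pos (Real.exp_pos _), Real.log_exp, EReal.coe_mul]

lemma log_div_le_iff {m : ℕ} (hm : 0 < m) (Z : ENNReal) (θ : ℝ) :
    ENNReal.log Z / ((m : ℝ) : EReal) ≤ (θ : EReal) ↔ Z ≤ ENNReal.ofReal (Real.exp (m * θ)) := by
  rw [EReal.div_le_iff_le_mul (by exact_mod_cast hm) (EReal.coe_ne_top _), ← log_ofReal_exp_eq,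
    ENNReal.log_le_log_iff]

lemma eventually_periodicSum_le {P θ : ℝ} (hP : pressure X φ = (P : EReal)) (hθ : P < θ) :
    ∀ᶠ m : ℕ in atTop, periodicSum X φ m ≤ ENNReal.ofReal (Real.exp (m * θ)) := by
  have h : limsup (fun m : ℕ => ENNReal.log (periodicSum X φ m) / ((m : ℝ) : EReal)) atTop < θ := by
    change pressure X φ < θ
    rw [hP]; exact_mod_cast hθ
  filter_upwards [eventually_lt_of_limsup_lt h, eventually_gt_atTop 0] with m hm hm0
  exact (log_div_le_iff hm0 _ _).1 hm.le

lemma not_eventually_periodicSum_le {P θ : ℝ} (hP : pressure X φ = (P : EReal)) (hθ : θ < P) :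
    ¬ ∀ᶠ m : ℕ in atTop, periodicSum X φ m ≤ ENNReal.ofReal (Real.exp (m * θ)) := by
  intro h
  have : pressure X φ ≤ (θ : EReal) := by
    refine limsup_le_of_le (h := ?_)
    filter_upwards [h, eventually_gt_atTop 0] with m hm hm0
    exact (log_div_le_iff hm0 _ _).2 hm
  rw [hP] at this
  exact absurd (EReal.coe_le_coe_iff.1 this) (not_le.2 hθ)

lemma birkhoffSum_smul' (t : ℝ) (m : ℕ) (x : X.carrier) :
    birkhoffSum (shiftMap X) (t • φ) m x = t * birkhoffSum (shiftMap X) φ m x := by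
  simp [birkhoffSum, Finset.mul_sum]

lemma shiftMap_iterate (m : ℕ) (x : X.carrier) (g : G) :
    ((shiftMap X)^[m] x).1 g = x.1 ((m : G) + g) := by
  induction m generalizing g with
  | zero => simp
  | succ m ih =>
    rw [Function.iterate_succ_apply']
    change ((shiftMap X)^[m] x).1 (1 + g) = _
    rw [ih, Nat.cast_succ, add_assoc]

lemma isPeriodicPt_shiftMap_iff {m : ℕ} {x : X.carrier} :
    Function.IsPeriodicPt (shiftMap X) m x ↔ ∀ g, x.1 ((m : G) + g) = x.1 g := by
  rw [Function.IsPeriodicPt, Function.IsFixedPt, Subtype.ext_iff, funext_iff]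
  simp only [shiftMap_iterate]

lemma birkhoffSum_mul_period {m : ℕ} {x : X.carrier}
    (hx : Function.IsPeriodicPt (shiftMap X) m x) (k : ℕ) :
    birkhoffSum (shiftMap X) φ (k * m) x = k * birkhoffSum (shiftMap X) φ m x := by
  induction k with
  | zero => simp
  | succ k ih =>
    have : (shiftMap X)^[k * m] x = x := hx.const_mul k
    rw [Nat.succ_mul, birkhoffSum_add, this, ih]
    push_cast; ring

lemma ofReal_exp_le_periodicSum {m : ℕ} {x : X.carrier}
    (hx : Function.IsPeriodicPt (shiftMap X) m x) :
    ENNReal.ofReal (Real.exp (birkhoffSum (shiftMap X) φ m x)) ≤ periodicSum X φ m :=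
  ENNReal.le_tsum (f := fun x : {x : X.carrier // Function.IsPeriodicPt (shiftMap X) m x} =>
    ENNReal.ofReal (Real.exp (birkhoffSum (shiftMap X) φ m x.1))) ⟨x, hx⟩

/-- The slope at infinity of the pressure bounds the averages over periodic orbits. -/
lemma birkhoffSum_le_of_pressure {a b : ℝ} {g : ℝ → ℝ}
    (hg : ∀ c, ∀ᶠ t in atTop, g t < Real.exp (-c * t))
    (hP : ∀ᶠ t in atTop, pressure X (t • φ) = ((a * t + b + g t : ℝ) : EReal))
    {m : ℕ} {x : X.carrier} (hx : Function.IsPeriodicPt (shiftMap X) m x) :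
    birkhoffSum (shiftMap X) φ m x ≤ m * a := by
  rcases Nat.eq_zero_or_pos m with rfl | hm
  · simp
  set s := birkhoffSum (shiftMap X) φ m x with hs
  -- The bound on periodic sums holds only for large periods, so it is applied to a multiple `k *
  -- m`, and `k` cancels. Letting `t` grow then forces `s ≤ m * a`.
  have key : ∀ᶠ t : ℝ in atTop, t * (s - m * a) ≤ m * (b + 2) := by
    filter_upwards [hP, hg 0] with t h1 h2
    have h3 : g t < 1 := by simpa using h2
    have h4 := eventually_periodicSum_le h1 (θ := a * t + b + 2) (by linarith)
    have h5 : Tendsto (fun k : ℕ => k * m) atTop atTop :=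
      tendsto_atTop_mono (fun k => Nat.le_mul_of_pos_right k hm) tendsto_id
    obtain ⟨k, h6, hk⟩ := ((h5.eventually h4).and (eventually_gt_atTop 0)).exists
    have h7 := (ofReal_exp_le_periodicSum (φ := t • φ) (hx.const_mul k)).trans h6
    rw [ENNReal.ofReal_le_ofReal_iff (Real.exp_pos _).le, Real.exp_le_exp, birkhoffSum_smul',
      birkhoffSum_mul_period hx, ← hs] at h7
    have hk' : (0 : ℝ) < k := by exact_mod_cast hk
    push_cast at h7
    have h8 : (k : ℝ) * (t * s) ≤ k * (m * (a * t + b + 2)) := by nlinarith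
    have h9 := le_of_mul_le_mul_left h8 hk'
    nlinarith
  by_contra hcon
  push Not at hcon
  have h1 : Tendsto (fun t : ℝ => t * (s - m * a)) atTop atTop :=
    tendsto_id.atTop_mul_const (by linarith)
  obtain ⟨t, h2, h3⟩ := (key.and (h1.eventually_gt_atTop (m * (b + 2)))).exists
  linarith

end PressureBounds

/-! ### One-sided and two-sided index sets. -/

/-- The properties of the index sets `ℕ` and `ℤ` of one-sided and two-sided sequences. -/
structure IsSequenceIndex (G : Type) [AddMonoidWithOne G] (size : G → ℕ) : Prop where
  exists_cast_eq : ∀ (j : ℕ) (i : G), size i ≤ j → ∃ k : ℕ, (j : G) + i = k ∧ k ≤ j + size i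
  exists_translate : ∀ (g : G) (m R : ℕ), 0 < m →
    ∃ k n : ℕ, ((k * m : ℕ) : G) + g = n ∧ R ≤ n
  exists_extension : ∀ {Λ : Type} (u : ℕ → Λ) (m : ℕ), 0 < m → (∀ n, u (n + m) = u n) →
    ∃ x : G → Λ, (∀ n : ℕ, x n = u n) ∧ ∀ g, x ((m : G) + g) = x g

lemma isSequenceIndex_nat : IsSequenceIndex ℕ id where
  exists_cast_eq j i _ := ⟨j + i, by simp⟩
  exists_translate g m R hm := ⟨R, R * m + g, by simp, by nlinarith⟩
  exists_extension u m _ hu := ⟨u, by simp, fun g => by rw [add_comm]; simpa using hu g⟩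

lemma isSequenceIndex_int : IsSequenceIndex ℤ Int.natAbs where
  exists_cast_eq j i h := ⟨(j + i).toNat, by omega, by omega⟩
  exists_translate g m R hm := by
    have h : (1 : ℤ) ≤ m := by exact_mod_cast hm
    have h2 : (0 : ℤ) ≤ (g.natAbs + R) * m + g - R := by
      have h3 : (g.natAbs : ℤ) + R ≤ (g.natAbs + R) * m := le_mul_of_one_le_right (by omega) h
      omega
    refine ⟨g.natAbs + R, (((g.natAbs + R) * m : ℤ) + g).toNat, ?_, ?_⟩
    · rw [Int.toNat_of_nonneg (by omega)]; push_cast; ring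
    · omega
  exists_extension u m hm hu := by
    have hper : Function.Periodic u m := hu
    refine ⟨fun i => u (i % m).toNat, fun n => ?_, fun g => ?_⟩
    · have : ((n : ℤ) % (m : ℤ)).toNat = n % m := by
        rw [← Int.natCast_mod, Int.toNat_natCast]
      change u ((n : ℤ) % (m : ℤ)).toNat = u n
      rw [this, hper.map_mod_nat]
    · simp

/-! ### Bounded distortion of Hölder potentials. -/

section Distortion

lemma visualDist_nonneg {Λ G : Type} {size : G → ℕ} (x y : G → Λ) : 0 ≤ visualDist size x y := by
  unfold visualDist; split_ifs <;> positivity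

lemma visualDist_le_one {Λ G : Type} {size : G → ℕ} (x y : G → Λ) : visualDist size x y ≤ 1 := by
  unfold visualDist
  split_ifs
  · norm_num
  · exact pow_le_one₀ (by norm_num) (by norm_num)

lemma visualDist_le_pow {Λ G : Type} {size : G → ℕ} {x y : G → Λ} {n : ℕ} (h : ∀ i, size i < n → x i = y i) :
    visualDist size x y ≤ (1 / 2 : ℝ) ^ n := by
  unfold visualDist
  split_ifs with hxy
  · positivity
  · obtain ⟨i, hi⟩ := Function.ne_iff.1 hxy
    obtain ⟨i', hi', hne⟩ := Nat.sInf_mem (s := {n : ℕ | ∃ i : G, size i = n ∧ x i ≠ y i})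
      ⟨size i, i, rfl, hi⟩
    refine pow_le_pow_of_le_one (by norm_num) (by norm_num) ?_
    rw [← hi']
    by_contra hlt
    exact hne (h i' (not_le.1 hlt))

variable {Λ G : Type} [TopologicalSpace Λ] [AddMonoidWithOne G] {size : G → ℕ}
  {X : Subshift Λ G} {φ : X.carrier → ℝ}

lemma IsHolderPotential.exists_bound (hφ : IsHolderPotential size X φ) :
    ∃ B, ∀ x, |φ x| ≤ B := by
  obtain ⟨C, h, hC, hh, -, hφ⟩ := hφ
  rcases isEmpty_or_nonempty X.carrier with he | ⟨⟨x₀⟩⟩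
  · exact ⟨0, fun x => (he.false x).elim⟩
  · refine ⟨C + |φ x₀|, fun x => ?_⟩
    have h1 : |φ x - φ x₀| ≤ C := (hφ x x₀).trans (mul_le_of_le_one_right hC
      (Real.rpow_le_one (visualDist_nonneg _ _) (visualDist_le_one _ _) hh.le))
    have h2 := abs_add_le (φ x - φ x₀) (φ x₀)
    rw [sub_add_cancel] at h2
    linarith

lemma sum_pow_min_le {r : ℝ} (hr0 : 0 ≤ r) (hr1 : r < 1) (n : ℕ) :
    ∑ j ∈ Finset.range n, r ^ min j (n - 1 - j) ≤ 2 * (1 - r)⁻¹ := by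
  have h1 : ∑ j ∈ Finset.range n, r ^ j ≤ (1 - r)⁻¹ := by
    rw [← tsum_geometric_of_lt_one hr0 hr1]
    exact (summable_geometric_of_lt_one hr0 hr1).sum_le_tsum _ (fun _ _ => by positivity)
  calc ∑ j ∈ Finset.range n, r ^ min j (n - 1 - j)
      ≤ ∑ j ∈ Finset.range n, (r ^ j + r ^ (n - 1 - j)) := by
        refine Finset.sum_le_sum fun j _ => ?_
        rcases min_choice j (n - 1 - j) with h | h <;> rw [h]
        · have : 0 ≤ r ^ (n - 1 - j) := by positivity
          linarith
        · have : 0 ≤ r ^ j := by positivity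
          linarith
    _ = 2 * ∑ j ∈ Finset.range n, r ^ j := by
        rw [Finset.sum_add_distrib, Finset.sum_range_reflect (fun j => r ^ j) n, two_mul]
    _ ≤ _ := by linarith

/-- Birkhoff sums of a Hölder potential along orbits which agree on `0, …, n - 1` are uniformly
close. -/
lemma IsHolderPotential.exists_distortion (hG : IsSequenceIndex G size)
    (hφ : IsHolderPotential size X φ) : ∃ K, ∀ (x y : X.carrier) (n : ℕ),
      (∀ k : ℕ, k < n → x.1 k = y.1 k) →
      |birkhoffSum (shiftMap X) φ n x - birkhoffSum (shiftMap X) φ n y| ≤ K := by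
  obtain ⟨C, h, hC, hh, -, hφ⟩ := hφ
  set r : ℝ := (1 / 2 : ℝ) ^ h with hr
  have hr0 : 0 ≤ r := by positivity
  have hr1 : r < 1 := Real.rpow_lt_one (by norm_num) (by norm_num) hh
  refine ⟨C * (2 * (1 - r)⁻¹), fun x y n hxy => ?_⟩
  rw [birkhoffSum, birkhoffSum, ← Finset.sum_sub_distrib]
  refine (Finset.abs_sum_le_sum_abs _ _).trans ?_
  refine le_trans ?_ (mul_le_mul_of_nonneg_left (sum_pow_min_le hr0 hr1 n) hC)
  rw [Finset.mul_sum]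
  refine Finset.sum_le_sum fun j hj => (hφ _ _).trans (mul_le_mul_of_nonneg_left ?_ hC)
  have hjn := Finset.mem_range.1 hj
  -- Around position `j` the orbits agree up to the nearer end of `0, …, n - 1`; this covers both
  -- sides of a two-sided sequence.
  have h1 : visualDist size ((shiftMap X)^[j] x).1 ((shiftMap X)^[j] y).1 ≤
      (1 / 2 : ℝ) ^ min j (n - 1 - j) := by
    refine visualDist_le_pow fun i hi => ?_
    obtain ⟨k, hk, hk2⟩ := hG.exists_cast_eq j i (by omega)
    rw [shiftMap_iterate, shiftMap_iterate, hk]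
    exact hxy k (by omega)
  refine (Real.rpow_le_rpow (visualDist_nonneg _ _) h1 hh.le).trans (le_of_eq ?_)
  rw [hr, ← Real.rpow_natCast, ← Real.rpow_natCast, ← Real.rpow_mul (by norm_num),
    ← Real.rpow_mul (by norm_num), mul_comm]

end Distortion

/-! ### Recoding shifts of finite type by windows. -/

section Recoding

variable {Λ G : Type} [TopologicalSpace Λ] [AddMonoidWithOne G] {size : G → ℕ}
  {X : Subshift Λ G} {φ : X.carrier → ℝ} {M : ℕ}

/-- The sequence of windows of length `M + 1` of a configuration. -/
def windows (M : ℕ) (x : G → Λ) : ℕ → (Fin (M + 1) → Λ) := fun i k => x ((i + k : ℕ) : G)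

lemma windows_zero (x : X.carrier) (n : ℕ) : windows M x.1 n 0 = x.1 n := by simp [windows]

lemma seqTail_windows (x : X.carrier) :
    seqTail (windows M x.1) = windows M (shiftMap X x).1 := by
  funext i k
  change x.1 ((i + 1 + k : ℕ) : G) = x.1 (1 + ((i + k : ℕ) : G))
  rw [show i + 1 + (k : ℕ) = 1 + (i + k) by ring, Nat.cast_add, Nat.cast_one]

lemma seqTail_iterate_windows (n : ℕ) (x : X.carrier) :
    seqTail^[n] (windows M x.1) = windows M ((shiftMap X)^[n] x).1 := by
  induction n with
  | zero => rfl
  | succ n ih => rw [Function.iterate_succ_apply', ih, seqTail_windows,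
      Function.iterate_succ_apply']

/-- Translation by a common period moves any coordinate into `ℕ`, so even in the two-sided case
nonnegative coordinates determine a periodic point. -/
lemma eq_of_windows_eq (hG : IsSequenceIndex G size) {x y : X.carrier} {m n : ℕ} (hm : 0 < m)
    (hn : 0 < n) (hx : Function.IsPeriodicPt (shiftMap X) m x)
    (hy : Function.IsPeriodicPt (shiftMap X) n y) (h : windows M x.1 = windows M y.1) :
    x = y := by
  have hx' := isPeriodicPt_shiftMap_iff.1 (hx.mul_const n)
  have hy' := isPeriodicPt_shiftMap_iff.1 (hy.const_mul m)
  apply Subtype.ext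
  funext g
  obtain ⟨k, l, hkl, -⟩ := hG.exists_translate g (m * n) 0 (by positivity)
  have h1 := isPeriodicPt_shiftMap_iff.1 ((hx.mul_const n).const_mul k) g
  have h2 := isPeriodicPt_shiftMap_iff.1 ((hy.const_mul m).const_mul k) g
  rw [← h1, ← h2, hkl, ← windows_zero (M := M) x, ← windows_zero (M := M) y, h]

lemma isPeriodicPt_of_windows (hG : IsSequenceIndex G size) {x : X.carrier} {m n : ℕ} (hm : 0 < m)
    (hx : Function.IsPeriodicPt (shiftMap X) m x)
    (h : Function.IsPeriodicPt seqTail n (windows M x.1)) :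
    Function.IsPeriodicPt (shiftMap X) n x := by
  rw [isPeriodicPt_shiftMap_iff]
  intro g
  obtain ⟨k, l, hkl, -⟩ := hG.exists_translate g m 0 hm
  have h1 := isPeriodicPt_shiftMap_iff.1 (hx.const_mul k)
  rw [← h1 g, ← h1, ← add_assoc, ← Nat.cast_add, add_comm (k * m) n, Nat.cast_add, add_assoc, hkl,
    ← Nat.cast_add, ← windows_zero (M := M) x, ← windows_zero (M := M) x, add_comm n l]
  exact congrFun (isPeriodicPt_seqTail_iff.1 h l) 0

/-- The windows of the periodic points of a subshift. -/
def periodicWindows (X : Subshift Λ G) (M : ℕ) : Set (ℕ → (Fin (M + 1) → Λ)) :=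
  {y | ∃ x : X.carrier, (∃ m, 0 < m ∧ Function.IsPeriodicPt (shiftMap X) m x) ∧
    windows M x.1 = y}

open Classical in
/-- The potential induced on window sequences. -/
noncomputable def windowPotential (φ : X.carrier → ℝ) (M : ℕ)
    (y : ℕ → (Fin (M + 1) → Λ)) : ℝ :=
  if h : y ∈ periodicWindows X M then φ h.choose else 0

lemma windowPotential_windows (hG : IsSequenceIndex G size) {x : X.carrier} {m : ℕ} (hm : 0 < m)
    (hx : Function.IsPeriodicPt (shiftMap X) m x) :
    windowPotential φ M (windows M x.1) = φ x := by
  have h : windows M x.1 ∈ periodicWindows X M := ⟨x, ⟨m, hm, hx⟩, rfl⟩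
  rw [windowPotential, dif_pos h]
  obtain ⟨⟨n, hn, hy⟩, he⟩ := h.choose_spec
  rw [eq_of_windows_eq hG hn hm hy hx he]

lemma birkhoffSum_windows (hG : IsSequenceIndex G size) {x : X.carrier} {m : ℕ} (hm : 0 < m)
    (hx : Function.IsPeriodicPt (shiftMap X) m x) (n : ℕ) :
    birkhoffSum seqTail (windowPotential φ M) n (windows M x.1) =
      birkhoffSum (shiftMap X) φ n x := by
  refine Finset.sum_congr rfl fun k _ => ?_
  rw [seqTail_iterate_windows]
  exact windowPotential_windows hG hm (hx.apply_iterate k)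

/-- A periodic sequence of windows whose consecutive pairs occur in a shift of finite type, with
windows at least as long as the forbidden patterns, comes from a periodic point. -/
lemma mem_periodicWindows_of_pairs [Inhabited Λ] [DiscreteTopology Λ] [IsLeftCancelAdd G]
    (hG : IsSequenceIndex G size) {W : Set (Pattern Λ G)} (hX : X = Subshift.ofForbidden W)
    {R : ℕ} (hR : ∀ p ∈ W, ∀ f ∈ p.support, size f ≤ R)
    {y : ℕ → (Fin (2 * R + 1) → Λ)} {m : ℕ} (hm : 0 < m)
    (hy : Function.IsPeriodicPt seqTail m y)
    (hpair : ∀ i, ∃ z ∈ periodicWindows X (2 * R), z 0 = y i ∧ z 1 = y (i + 1)) :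
    y ∈ periodicWindows X (2 * R) := by
  rw [isPeriodicPt_seqTail_iff] at hy
  have hpair' : ∀ i, ∃ x : X.carrier, windows (2 * R) x.1 0 = y i ∧
      windows (2 * R) x.1 1 = y (i + 1) := by
    intro i
    obtain ⟨z, ⟨x, -, rfl⟩, hz⟩ := hpair i
    exact ⟨x, hz⟩
  choose x' hx0 hx1 using hpair'
  -- Consecutive windows overlap consistently, so `y` consists of the windows of its sequence of
  -- first letters.
  have hyk : ∀ k (hk : k < 2 * R + 1) i, y i ⟨k, hk⟩ = y (i + k) 0 := by
    intro k
    induction k with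
    | zero => intro _ _; rfl
    | succ k ih =>
      intro hk i
      have e : y (i + (k + 1)) 0 = y (i + 1) ⟨k, by omega⟩ := by
        rw [ih, add_assoc, add_comm 1 k]
      rw [e, ← hx0, ← hx1]
      simp only [windows]
      rw [show 0 + (k + 1) = 1 + k by ring]
  obtain ⟨x, hxu, hxm⟩ := hG.exists_extension (fun n => y n 0) m hm (fun n => by rw [hy])
  have hxX : x ∈ X.carrier := by
    rw [hX]
    intro p hp g hocc
    -- A forbidden pattern at `g` is moved by periods to some `n ≥ R`. It then lies in the window
    -- starting at `n - R`, which occurs in a point of `X`, centred at `R`; hence the window length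
    -- `2 * R + 1`.
    obtain ⟨k, n, hkn, hRn⟩ := hG.exists_translate g m R hm
    have hper : ∀ (k : ℕ) (h : G), x (((k * m : ℕ) : G) + h) = x h := by
      intro k
      induction k with
      | zero => simp
      | succ k ih =>
        intro h
        rw [Nat.succ_mul, Nat.cast_add, add_assoc, ih, hxm]
    have hx'X : ∀ z ∈ X.carrier, z ∈ (Subshift.ofForbidden W).carrier := by
      intro z hz; rwa [hX] at hz
    refine hx'X _ (x' (n - R)).2 p hp (R : G) fun f hf => ?_
    obtain ⟨k', hk', hk'2⟩ := hG.exists_cast_eq R f (hR p hp f hf)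
    have hk3 : k' < 2 * R + 1 := by have := hR p hp f hf; omega
    have h1 : windows (2 * R) (x' (n - R)).1 0 ⟨k', hk3⟩ = y (n - R) ⟨k', hk3⟩ := by rw [hx0]
    simp only [windows, zero_add] at h1
    rw [hk', h1, hyk, ← hocc f hf, ← hper k, ← add_assoc, hkn]
    have h2 : (n : G) + f = ((n - R + k' : ℕ) : G) := by
      have : n = n - R + R := by omega
      rw [this, Nat.cast_add, add_assoc, hk', ← Nat.cast_add, ← this]
    rw [h2, hxu]
  refine ⟨⟨x, hxX⟩, ⟨m, hm, isPeriodicPt_shiftMap_iff.2 hxm⟩, ?_⟩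
  funext i k
  simp only [windows, hxu]
  rw [← hyk k.1 k.2 i]

/-- The Markov system of windows of a shift of finite type, for a potential with nonpositive period
sums. -/
lemma exists_markovPeriodicSystem [Inhabited Λ] [DiscreteTopology Λ] [IsLeftCancelAdd G]
    (hG : IsSequenceIndex G size) (hX : IsShiftOfFiniteType X) (hφ : IsHolderPotential size X φ)
    {a : ℝ} (hnonpos : ∀ (m : ℕ) (x : X.carrier), Function.IsPeriodicPt (shiftMap X) m x →
      birkhoffSum (shiftMap X) φ m x ≤ m * a) :
    ∃ (M : ℕ) (Q : MarkovPeriodicSystem (Fin (M + 1) → Λ)), Q.pts = periodicWindows X M ∧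
      ∀ (x : X.carrier) (m n : ℕ), 0 < m → Function.IsPeriodicPt (shiftMap X) m x →
        Q.sum n (windows M x.1) = birkhoffSum (shiftMap X) φ n x - n * a := by
  obtain ⟨W, hW, hXW⟩ := hX
  obtain ⟨R, hR⟩ : ∃ R : ℕ, ∀ p ∈ W, ∀ f ∈ p.support, size f ≤ R := by
    obtain ⟨R, hR⟩ := (hW.image fun p => p.support.sup size).bddAbove
    exact ⟨R, fun p hp f hf => (Finset.le_sup hf).trans (hR (mem_image_of_mem _ hp))⟩
  obtain ⟨B, hB⟩ := hφ.exists_bound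
  obtain ⟨K, hK⟩ := hφ.exists_distortion hG
  have hsum : ∀ (x : X.carrier) (m n : ℕ), 0 < m → Function.IsPeriodicPt (shiftMap X) m x →
      birkhoffSum seqTail (windowPotential (fun x => φ x - a) (2 * R)) n (windows (2 * R) x.1) =
        birkhoffSum (shiftMap X) φ n x - n * a := by
    intro x m n hm hx
    rw [birkhoffSum_windows hG hm hx]
    simp [birkhoffSum, Finset.sum_sub_distrib]
  refine ⟨2 * R, ⟨periodicWindows X (2 * R), ?_, ?_, ?_,
    windowPotential (fun x => φ x - a) (2 * R), B + |a|, K, ?_, ?_, ?_⟩, rfl, hsum⟩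
  · rintro _ ⟨x, ⟨m, hm, hx⟩, rfl⟩
    refine ⟨m, hm, ?_⟩
    rw [Function.IsPeriodicPt, Function.IsFixedPt, seqTail_iterate_windows, hx]
  · rintro _ ⟨x, ⟨m, hm, hx⟩, rfl⟩
    exact ⟨shiftMap X x, ⟨m, hm, hx.apply⟩, (seqTail_windows x).symm⟩
  · exact fun y m hm hy h => mem_periodicWindows_of_pairs hG hXW hR hm hy h
  · rintro _ ⟨x, ⟨m, hm, hx⟩, rfl⟩
    rw [windowPotential_windows hG hm hx]
    exact (abs_sub _ _).trans (by have := hB x; linarith)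
  · rintro _ ⟨x, ⟨m, hm, hx⟩, rfl⟩ _ ⟨z, ⟨l, hl, hz⟩, rfl⟩ n h
    rw [hsum x m n hm hx, hsum z l n hl hz, sub_sub_sub_cancel_right]
    refine hK x z n fun k hk => ?_
    rw [← windows_zero (M := 2 * R) x, ← windows_zero (M := 2 * R) z, h k hk]
  · rintro _ ⟨x, ⟨m, hm, hx⟩, rfl⟩ n hn
    rw [hsum x m n hm hx]
    have := hnonpos n x (isPeriodicPt_of_windows hG hm hx hn)
    linarith

/-- Windows give a bijection of the points of period `m`, and removing `a` from the potential
divides each term by `exp (m * (a * t))`. An infinite sum in `ENNReal` is the supremum of its finite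
sums, which matches `SumLE`. -/
lemma sumLE_iff_periodicSum_le (hG : IsSequenceIndex G size)
    {Q : MarkovPeriodicSystem (Fin (M + 1) → Λ)} (hQ : Q.pts = periodicWindows X M) {a : ℝ}
    (hsum : ∀ (x : X.carrier) (m n : ℕ), 0 < m → Function.IsPeriodicPt (shiftMap X) m x →
        Q.sum n (windows M x.1) = birkhoffSum (shiftMap X) φ n x - n * a)
    {m : ℕ} (hm : 0 < m) (t θ : ℝ) :
    Q.SumLE (fun _ => True) m t (Real.exp (m * θ)) ↔
      periodicSum X (t • φ) m ≤ ENNReal.ofReal (Real.exp (m * (a * t + θ))) := by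
  classical
  let P := {x : X.carrier // Function.IsPeriodicPt (shiftMap X) m x}
  let β : P → ℕ → (Fin (M + 1) → Λ) := fun x => windows M x.1.1
  have hβ : Function.Injective β := fun x y h => Subtype.ext (eq_of_windows_eq hG hm hm x.2 y.2 h)
  have hterm : ∀ x : P, Real.exp (birkhoffSum (shiftMap X) (t • φ) m x.1) =
      Real.exp (m * (a * t)) * Real.exp (t * Q.sum m (β x)) := by
    intro x
    rw [← Real.exp_add, birkhoffSum_smul', hsum x.1 m m hm x.2]
    ring_nf
  have hexp : Real.exp (m * (a * t + θ)) = Real.exp (m * (a * t)) * Real.exp (m * θ) := by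
    rw [← Real.exp_add]; ring_nf
  have hfin : ∀ s : Finset P, ∑ x ∈ s, ENNReal.ofReal
      (Real.exp (birkhoffSum (shiftMap X) (t • φ) m x.1)) ≤
        ENNReal.ofReal (Real.exp (m * (a * t + θ))) ↔
      ∑ y ∈ s.image β, Real.exp (t * Q.sum m y) ≤ Real.exp (m * θ) := by
    intro s
    rw [← ENNReal.ofReal_sum_of_nonneg (fun _ _ => (Real.exp_pos _).le),
      ENNReal.ofReal_le_ofReal_iff (Real.exp_pos _).le, Finset.sum_image hβ.injOn,
      Finset.sum_congr rfl fun x _ => hterm x, ← Finset.mul_sum, hexp]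
    exact mul_le_mul_iff_right₀ (Real.exp_pos _)
  have hmem : ∀ x : P, β x ∈ Q.pts ∧ Function.IsPeriodicPt seqTail m (β x) := by
    intro x
    refine ⟨?_, ?_⟩
    · rw [hQ]; exact ⟨x.1, ⟨m, hm, x.2⟩, rfl⟩
    · rw [Function.IsPeriodicPt, Function.IsFixedPt, seqTail_iterate_windows, x.2]
  rw [periodicSum, ENNReal.tsum_eq_iSup_sum, iSup_le_iff]
  constructor
  · intro h s
    refine (hfin s).2 (h _ fun y hy => ?_)
    obtain ⟨x, -, rfl⟩ := Finset.mem_image.1 hy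
    exact ⟨(hmem x).1, (hmem x).2, trivial⟩
  · intro h F hF
    have hrange : (F : Set (ℕ → (Fin (M + 1) → Λ))) ⊆ range β := by
      intro y hy
      obtain ⟨hy1, hy2, -⟩ := hF y hy
      rw [hQ] at hy1
      obtain ⟨x, ⟨n, hn, hx⟩, rfl⟩ := hy1
      exact ⟨⟨x, isPeriodicPt_of_windows hG hn hx hy2⟩, rfl⟩
    have := (hfin (F.preimage β hβ.injOn)).1 (h _)
    rwa [Finset.image_preimage, Finset.filter_true_of_mem fun y hy => hrange hy] at this

end Recoding

/-- The pressure of a Hölder potential on a shift of finite type cannot approach its asymptote from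
above faster than any exponential. -/
theorem not_isHolderPressureOver {G : Type} [AddMonoidWithOne G] [IsLeftCancelAdd G] {size : G → ℕ}
    (hG : IsSequenceIndex G size) {α a b : ℝ} {F g : ℝ → ℝ}
    (hF : ∀ t ∈ Ioi α, F t = a * t + b + g t) (hg0 : ∀ᶠ t in atTop, 0 < g t)
    (hg : ∀ c, ∀ᶠ t in atTop, g t < Real.exp (-c * t)) : ¬ IsHolderPressureOver G size α F := by
  rintro ⟨Λ, _, _, _, _, X, φ, hX, hφ, hP⟩
  have hP' : ∀ᶠ t in atTop, pressure X (t • φ) = ((a * t + b + g t : ℝ) : EReal) := by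
    filter_upwards [eventually_gt_atTop α] with t ht
    rw [hP t ht, hF t ht]
  obtain ⟨M, Q, hQ, hsum⟩ := exists_markovPeriodicSystem hG hX hφ (a := a)
    fun m x hx => birkhoffSum_le_of_pressure hg hP' hx
  refine Q.not_superexponential_rate (b := b) hg0 hg ?_ ?_
  · filter_upwards [hP'] with t ht θ hθ
    filter_upwards [eventually_periodicSum_le ht (θ := a * t + θ) (by linarith),
      eventually_gt_atTop 0] with m h1 hm
    exact (sumLE_iff_periodicSum_le hG hQ hsum hm t θ).2 h1
  · filter_upwards [hP'] with t ht θ hθ hcon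
    refine not_eventually_periodicSum_le ht (θ := a * t + θ) (by linarith) ?_
    filter_upwards [hcon, eventually_gt_atTop 0] with m h1 hm
    exact (sumLE_iff_periodicSum_le hG hQ hsum hm t θ).1 h1

/-! ### The explicit functions. -/

section ExplicitFunction

variable {a b c t : ℝ}

lemma hasDerivAt_gauss (c t : ℝ) :
    HasDerivAt (fun t : ℝ => Real.exp (-c * t ^ 2)) (-(2 * c * t) * Real.exp (-c * t ^ 2)) t := by
  have h : HasDerivAt (fun t : ℝ => -c * t ^ 2) (-c * (2 * t)) t := by
    simpa using (hasDerivAt_pow 2 t).const_mul (-c)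
  convert h.exp using 1; ring

lemma hasDerivAt_explicitF (a b c : ℝ) (ht : t ≠ 0) :
    HasDerivAt (explicitF a b c)
      (a - Real.exp (-c * t ^ 2) * (2 * c * t + 2 * c + 1 / t ^ 2)) t := by
  have h1 : HasDerivAt (fun t : ℝ => a * t + b) a t := by
    simpa using ((hasDerivAt_id t).const_mul a).add_const b
  have h2 := hasDerivAt_gauss c t
  have h3 := h2.div (hasDerivAt_id t) ht
  refine HasDerivAt.congr_deriv (f := explicitF a b c) ((h1.add h2).add h3) ?_
  simp only [id]
  field_simp
  ring

lemma hasDerivAt_deriv_explicitF (a b c : ℝ) (ht : 0 < t) :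
    HasDerivAt (deriv (explicitF a b c))
      (Real.exp (-c * t ^ 2) * (4 * c ^ 2 * t ^ 2 + 4 * c ^ 2 * t - 2 * c + 2 * c / t + 2 / t ^ 3))
      t := by
  have he : deriv (explicitF a b c) =ᶠ[nhds t]
      fun t => a - Real.exp (-c * t ^ 2) * (2 * c * t + 2 * c + 1 / t ^ 2) := by
    filter_upwards [lt_mem_nhds ht] with s hs
    exact (hasDerivAt_explicitF a b c hs.ne').deriv
  refine HasDerivAt.congr_of_eventuallyEq ?_ he
  have h1 : HasDerivAt (fun t : ℝ => 2 * c * t + 2 * c + 1 / t ^ 2) (2 * c - 2 / t ^ 3) t := by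
    have h2 : HasDerivAt (fun t : ℝ => 1 / t ^ 2) (-2 / t ^ 3) t := by
      have := (hasDerivAt_pow 2 t).inv (pow_ne_zero 2 ht.ne')
      simp only [one_div]
      refine HasDerivAt.congr_deriv this ?_
      push_cast
      field_simp
    have h3 : HasDerivAt (fun t : ℝ => 2 * c * t + 2 * c) (2 * c) t := by
      simpa using ((hasDerivAt_id t).const_mul (2 * c)).add_const (2 * c)
    exact (h3.add h2).congr_deriv (by ring)
  refine HasDerivAt.congr_deriv (((hasDerivAt_gauss c t).mul h1).const_sub a) ?_
  field_simp
  ring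

lemma one_eighth_lt_of_lt (hc : 1 / (2 * Real.sqrt 2) < c) : 1 / 8 < c := by
  refine lt_trans ?_ hc
  have h : Real.sqrt 2 < 2 := by
    rw [Real.sqrt_lt' (by norm_num)]; norm_num
  rw [div_lt_div_iff₀ (by norm_num) (by positivity)]
  linarith

lemma strictConvexOn_explicitF {α : ℝ} (hα : 0 < α) (hc : 1 / 8 < c) :
    StrictConvexOn ℝ (Ioi α) (explicitF a b c) := by
  refine strictConvexOn_of_deriv2_pos (convex_Ioi α) ?_ ?_
  · exact fun t ht => (hasDerivAt_explicitF a b c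
      (hα.trans ht).ne').continuousAt.continuousWithinAt
  · intro t ht
    rw [interior_Ioi] at ht
    have ht0 : 0 < t := hα.trans ht
    have hc0 : 0 < c := by linarith
    simp only [Function.iterate_succ, Function.iterate_zero, Function.comp_apply, id]
    rw [(hasDerivAt_deriv_explicitF a b c ht0).deriv]
    refine mul_pos (Real.exp_pos _) ?_
    have h1 : 0 < 4 * c ^ 2 * t ^ 2 + 2 / t ^ 3 := by positivity
    have h2 : 0 ≤ 4 * c ^ 2 * t - 2 * c + 2 * c / t := by
      have : 4 * c ^ 2 * t - 2 * c + 2 * c / t = 2 * c * (2 * c * t ^ 2 - t + 1) / t := by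
        field_simp
        ring
      rw [this]
      -- The discriminant is `1 - 8 * c`, which is why `1 / 8 < c` suffices.
      have h3 : 0 ≤ 2 * c * t ^ 2 - t + 1 := by nlinarith [sq_nonneg (t - 2), sq_nonneg t]
      positivity
    linarith

lemma gauss_bounds {α : ℝ} (hα : 0 < α) (hc : 0 < c) (ht : α < t) :
    Real.exp (-c * t ^ 2) ≤ 1 ∧ c * t ^ 2 * Real.exp (-c * t ^ 2) ≤ 1 ∧
      c * t * Real.exp (-c * t ^ 2) ≤ 1 / α ∧ 1 / t ≤ 1 / α := by
  have ht0 : 0 < t := hα.trans ht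
  have hx : 0 ≤ c * t ^ 2 := by positivity
  have h1 : Real.exp (-c * t ^ 2) ≤ 1 := by
    rw [← Real.exp_zero]; apply Real.exp_le_exp.2; nlinarith
  have h2 : c * t ^ 2 * Real.exp (-c * t ^ 2) ≤ 1 := by
    rw [neg_mul, Real.exp_neg, ← div_eq_mul_inv, div_le_one (Real.exp_pos _)]
    linarith [Real.add_one_le_exp (c * t ^ 2)]
  have h4 : 1 / t ≤ 1 / α := one_div_le_one_div_of_le hα ht.le
  refine ⟨h1, h2, le_trans ?_ h4, h4⟩
  rw [le_div_iff₀ ht0]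
  linarith

lemma exists_lipschitzOnWith_explicitF {α : ℝ} (hα : 0 < α) (hc : 0 < c) :
    ∃ L, LipschitzOnWith L (explicitF a b c) (Ioi α) := by
  refine ⟨Real.toNNReal (|a| + (2 / α + 2 * c + (1 / α) ^ 2)),
    (convex_Ioi α).lipschitzOnWith_of_nnnorm_deriv_le
      (fun t ht => (hasDerivAt_explicitF a b c (hα.trans ht).ne').differentiableAt) ?_⟩
  intro t ht
  have ht0 : 0 < t := hα.trans ht
  rw [(hasDerivAt_explicitF a b c ht0.ne').deriv, ← NNReal.coe_le_coe, coe_nnnorm,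
    Real.coe_toNNReal _ (by positivity), Real.norm_eq_abs]
  refine (abs_sub _ _).trans (add_le_add_right ?_ _)
  rw [abs_of_nonneg (by positivity)]
  obtain ⟨h1, -, h3, h4⟩ := gauss_bounds hα hc ht
  have h5 : 1 / t ^ 2 ≤ (1 / α) ^ 2 := by
    rw [← one_div_pow]; exact pow_le_pow_left₀ (by positivity) h4 2
  have h6 : Real.exp (-c * t ^ 2) * (1 / t ^ 2) ≤ 1 * (1 / α) ^ 2 :=
    mul_le_mul h1 h5 (by positivity) (by norm_num)
  have h7 : Real.exp (-c * t ^ 2) * (2 * c) ≤ 2 * c := by nlinarith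
  have h8 : 2 / α = 2 * (1 / α) := by ring
  rw [h8]
  linarith

/-- Differentiability leaves the derivative as the only supporting slope. The intercept is then `b`
plus positive terms, each bounded by `gauss_bounds`. -/
lemma supportingLinesBounded_explicitF {α : ℝ} (hα : 0 < α) (hb : 0 < b) (hc : 0 < c) :
    SupportingLinesBounded α (explicitF a b c) := by
  refine ⟨0, b + 3 + 4 / α, le_rfl, by positivity, fun t ht k hk => ?_⟩
  have ht0 : 0 < t := hα.trans ht
  have hder := hasDerivAt_explicitF a b c ht0.ne'
  have hk' : k = a - Real.exp (-c * t ^ 2) * (2 * c * t + 2 * c + 1 / t ^ 2) := by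
    have h1 : HasDerivAt (fun s => explicitF a b c s - k * (s - t))
        (a - Real.exp (-c * t ^ 2) * (2 * c * t + 2 * c + 1 / t ^ 2) - k) t := by
      have : HasDerivAt (fun s : ℝ => k * (s - t)) k t := by
        simpa using ((hasDerivAt_id t).sub_const t).const_mul k
      exact hder.sub this
    have h2 : IsLocalMin (fun s => explicitF a b c s - k * (s - t)) t := by
      filter_upwards [Ioi_mem_nhds ht] with s hs
      have := hk s hs
      simp only [sub_self, mul_zero, sub_zero]
      linarith
    have := h2.hasDerivAt_eq_zero h1
    linarith
  have e : explicitF a b c t - k * t = b + (Real.exp (-c * t ^ 2) +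
      2 * (Real.exp (-c * t ^ 2) * (1 / t)) + 2 * (c * t ^ 2 * Real.exp (-c * t ^ 2)) +
      2 * (c * t * Real.exp (-c * t ^ 2))) := by
    rw [hk', explicitF]; field_simp; ring
  rw [e]
  obtain ⟨h1, h2, h3, h4⟩ := gauss_bounds hα hc ht
  constructor
  · positivity
  · have h5 : Real.exp (-c * t ^ 2) * (1 / t) ≤ 1 * (1 / α) :=
      mul_le_mul h1 h4 (by positivity) (by norm_num)
    have h6 : 4 / α = 4 * (1 / α) := by ring
    rw [h6]
    linarith

lemma analyticOnNhd_explicitF {α : ℝ} (hα : 0 < α) :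
    AnalyticOnNhd ℝ (explicitF a b c) (Ioi α) := by
  intro t ht
  have ht0 : t ≠ 0 := (hα.trans ht).ne'
  have h1 : AnalyticAt ℝ (fun t : ℝ => Real.exp (-c * t ^ 2)) t := by fun_prop
  have h2 : AnalyticAt ℝ (fun t : ℝ => a * t + b) t := by fun_prop
  exact (h2.add h1).add (h1.div analyticAt_id ht0)

lemma isCandidate_explicitF {α : ℝ} (hα : 0 < α) (hb : 0 < b) (hc : 1 / 8 < c) :
    IsCandidate α (explicitF a b c) :=
  ⟨strictConvexOn_explicitF hα hc, analyticOnNhd_explicitF hα,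
    exists_lipschitzOnWith_explicitF hα (by linarith),
    supportingLinesBounded_explicitF hα hb (by linarith)⟩

lemma not_isHolderPressure_explicitF (α a b : ℝ) (hc : 0 < c) :
    ¬ IsHolderPressure α (explicitF a b c) := by
  set g : ℝ → ℝ := fun t => Real.exp (-c * t ^ 2) * (1 + 1 / t) with hg
  have hF : ∀ t ∈ Ioi α, explicitF a b c t = a * t + b + g t := by
    intro t _
    simp only [hg, explicitF]; ring
  have hg0 : ∀ᶠ t in atTop, 0 < g t := by
    filter_upwards [eventually_gt_atTop 0] with t ht
    positivity
  have hg1 : ∀ d, ∀ᶠ t in atTop, g t < Real.exp (-d * t) := by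
    intro d
    -- The first condition gives `1 + 1 / t ≤ 2 < exp 1`; with the second, `c * t ^ 2` exceeds `d *
    -- t + 1`.
    filter_upwards [eventually_ge_atTop 1, eventually_gt_atTop ((d + 1) / c)] with t h1 h2
    have ht0 : 0 < t := by linarith
    rw [div_lt_iff₀ hc] at h2
    have h3 : 1 + 1 / t ≤ 2 := by
      have : 1 / t ≤ 1 := by rw [div_le_one ht0]; exact h1
      linarith
    have h4 : (2 : ℝ) < Real.exp 1 := by linarith [Real.exp_one_gt_d9]
    calc g t ≤ Real.exp (-c * t ^ 2) * 2 := mul_le_mul_of_nonneg_left h3 (Real.exp_pos _).le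
      _ < Real.exp (-c * t ^ 2) * Real.exp 1 := mul_lt_mul_of_pos_left h4 (Real.exp_pos _)
      _ ≤ Real.exp (-d * t) := by
        rw [← Real.exp_add]
        apply Real.exp_le_exp.2
        nlinarith
  rintro (h | h)
  · exact not_isHolderPressureOver isSequenceIndex_nat hF hg0 hg1 h
  · exact not_isHolderPressureOver isSequenceIndex_int hF hg0 hg1 h

end ExplicitFunction

theorem mainTheorem1 :
    (∀ α : ℝ, 0 < α → ∃ F : ℝ → ℝ, IsCandidate α F ∧ ¬ IsHolderPressure α F) ∧
    (∀ α a b c : ℝ, 0 < α → 0 < a → 0 < b → 1 / (2 * Real.sqrt 2) < c →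
      IsCandidate α (explicitF a b c) ∧ ¬ IsHolderPressure α (explicitF a b c)) := by
  refine ⟨fun α hα => ⟨explicitF 1 1 1, isCandidate_explicitF hα one_pos (by norm_num),
    not_isHolderPressure_explicitF α 1 1 one_pos⟩, fun α a b c hα _ hb hc => ?_⟩
  have hc' := one_eighth_lt_of_lt hc
  exact ⟨isCandidate_explicitF hα hb hc', not_isHolderPressure_explicitF α a b (by linarith)⟩
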